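/- Let $\Bbbk$ be an algebraically closed field of characteristic zero and let $\xi\in\Bbbk$ be a primitive fourth root of unity. Let $\mathcal K$ be the Hopf algebra over $\Bbbk$ generated as an algebra by $a,b,c,d$ with relations $$ab=\xi ba,\quad ac=\xi ca,\quad cb=bc=0,\quad cd=\xi dc,\quad bd=\xi db,\quad ad=da=1,\quad b^2=c^2=0,\quad a^2c=b,\quad a^4=1,$$ with comultiplication $$\Delta(a)=a\otimes a+b\otimes c,\quad \Delta(b)=a\otimes b+b\otimes d,\quad \Delta(c)=c\otimes a+d\otimes c,\quad \Delta(d)=c\otimes b+d\otimes d,$$ counit $\varepsilon(a)=\varepsilon(d)=1$, $\varepsilon(b)=\varepsilon(c)=0$, and antipode $\mathcal S(a)=d$, $\mathcal S(b)=\xi b$, $\mathcal S(c)=-\xi c$, $\mathcal S(d)=a$. Let $V_{2,3}$ be the left Yetter--Drinfeld module over $\mathcal K$ with basis $e_1,e_2$, action $$a e_1=-e_1,\ \ b e_1=c e_1=0,\ \ d e_1=-e_1,\qquad a e_2=\xi e_2,\ \ b e_2=c e_2=e_1,\ \ d e_2=-\xi e_2,$$ and coaction $$\delta(e_1)=a\otimes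 e_1-(1+\xi)\,b\otimes e_2,\qquad \delta(e_2)=d\otimes e_2+\tfrac12(\xi-1)\,c\otimes e_1 .$$ A Nichols algebra of a Yetter--Drinfeld module $V$ over a Hopf algebra $H$ is an $\mathbb N$-graded Hopf algebra $R=\bigoplus_{n\ge 0}R(n)$ in the braided monoidal category ${}^H_H\mathcal{YD}$ of left Yetter--Drinfeld modules over $H$, with braiding $m\otimes n\mapsto m_{(-1)}\cdot n\otimes m_{(0)}$, together with an isomorphism $R(1)\simeq V$ of Yetter--Drinfeld modules, such that $R(0)\simeq\Bbbk$, $R(1)$ is the space of primitive elements of $R$, and $R$ is generated as an algebra by $R(1)$. Then the Nichols algebra $\mathfrak B(V_{2,3})$ is the algebra generated by $x=e_1$ and $y=e_2$ subject to the relations $$x^2=0,\qquad xy-\xi yx=0,\qquad y^4=0,$$ and $\dim_\Bbbk\mathfrak B(V_{2,3})=8$. More precisely, let $A$ be the algebra presented by $x,y$ and these relations. Then $\dim_\Bbbk A=8$; $A$ carries the structure of a Nichols algebra of $V_{2,3}$ in which $e_1,e_2\in V_{2,3}\simeq A(1)$ correspond to $x,y$; and for every Nichols algebra $R$ of $V_{2,3}$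 there is an algebra isomorphism $A\to R$ sending $x,y$ to the elements of $R(1)\simeq V_{2,3}$ that correspond to $e_1,e_2$, so that $\dim_\Bbbk R=8$. -/

import Mathlib

open scoped TensorProduct

universe u v w

noncomputable section

/-! ### Yetter-Drinfeld modules over a Hopf algebra -/

section YetterDrinfeld

variable (k : Type u) [Field k] (H : Type v) [Ring H] [HopfAlgebra k H]

/-- For a representation `act` of `H` on `V`, the linear map
`h₁ ⊗ (h₂ ⊗ h₃) ↦ (m ⊗ v ↦ h₁ m S(h₃) ⊗ h₂ · v)`; see `ydTwist_tmul`. -/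
def ydTwist {V : Type w} [AddCommGroup V] [Module k V] (act : H →ₐ[k] Module.End k V) :
    H ⊗[k] (H ⊗[k] H) →ₗ[k] (H ⊗[k] V →ₗ[k] H ⊗[k] V) :=
  TensorProduct.lift
    ((TensorProduct.lift.equiv (RingHom.id k) H H (H ⊗[k] V →ₗ[k] H ⊗[k] V)).toLinearMap ∘ₗ
      LinearMap.mk₂ k
        (fun h₁ h₂ =>
          (TensorProduct.mapBilinear (RingHom.id k) H V H V).flip (act h₂) ∘ₗ
            (LinearMap.mul k H h₁).compRight k ∘ₗ
              (LinearMap.mul k H).flip ∘ₗ HopfAlgebra.antipode k)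
        (by intros; ext; simp [TensorProduct.add_tmul])
        (by intros; ext; simp [TensorProduct.smul_tmul'])
        (by intros; ext; simp)
        (by intros; ext; simp))

theorem ydTwist_tmul {V : Type w} [AddCommGroup V] [Module k V] (act : H →ₐ[k] Module.End k V)
    (h₁ h₂ h₃ m : H) (v : V) :
    ydTwist k H act (h₁ ⊗ₜ (h₂ ⊗ₜ h₃)) (m ⊗ₜ v) =
      (h₁ * (m * HopfAlgebra.antipode k h₃)) ⊗ₜ[k] (act h₂ v) := by
  simp [ydTwist]

/-- The iterated comultiplication `h ↦ h₍₁₎ ⊗ (h₍₂₎ ⊗ h₍₃₎)`. -/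
def comulThree : H →ₐ[k] H ⊗[k] (H ⊗[k] H) :=
  (Algebra.TensorProduct.map (AlgHom.id k H) (Bialgebra.comulAlgHom k H)).comp
    (Bialgebra.comulAlgHom k H)

theorem ydTwist_mul {V : Type w} [AddCommGroup V] [Module k V] (act : H →ₐ[k] Module.End k V)
    (s t : H ⊗[k] (H ⊗[k] H)) (z : H ⊗[k] V) :
    ydTwist k H act (s * t) z = ydTwist k H act s (ydTwist k H act t z) := by
  induction s with
  | zero => simp
  | add s₁ s₂ h₁ h₂ => simp only [add_mul, map_add, LinearMap.add_apply, h₁, h₂]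
  | tmul a s =>
    induction s with
    | zero => simp
    | add s₁ s₂ h₁ h₂ =>
      simp only [TensorProduct.tmul_add, add_mul, map_add, LinearMap.add_apply, h₁, h₂]
    | tmul b c =>
      induction t with
      | zero => simp
      | add s₁ s₂ h₁ h₂ => simp only [mul_add, map_add, LinearMap.add_apply, h₁, h₂]
      | tmul a' t =>
        induction t with
        | zero => simp
        | add s₁ s₂ h₁ h₂ =>
          simp only [TensorProduct.tmul_add, mul_add, map_add, LinearMap.add_apply, h₁, h₂]
        | tmul b' c' =>
          induction z with
          | zero => simp
          | add s₁ s₂ h₁ h₂ => simp only [map_add, h₁, h₂]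
          | tmul m v =>
            simp only [Algebra.TensorProduct.tmul_mul_tmul, ydTwist_tmul, map_mul,
              Module.End.mul_apply, HopfAlgebra.antipode_mul_antidistrib, mul_assoc]

/-- A left Yetter-Drinfeld module over the Hopf algebra `H`: a left action `h · v = act h v` and
a left coaction `δ = coact` with `δ(h · v) = h₍₁₎ v₍₋₁₎ S(h₍₃₎) ⊗ h₍₂₎ · v₍₀₎`. -/
structure YDModule (V : Type w) [AddCommGroup V] [Module k V] where
  act : H →ₐ[k] Module.End k V
  coact : V →ₗ[k] H ⊗[k] V
  coassoc : (TensorProduct.assoc k H H V).toLinearMap ∘ₗ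
      (Coalgebra.comul (R := k) (A := H)).rTensor V ∘ₗ coact = coact.lTensor H ∘ₗ coact
  counit_coact : (TensorProduct.lid k V).toLinearMap ∘ₗ
      (Coalgebra.counit (R := k) (A := H)).rTensor V ∘ₗ coact = LinearMap.id
  compat : ∀ (h : H) (v : V), coact (act h v) = ydTwist k H act (comulThree k H h) (coact v)

variable {k H}

namespace YDModule

variable {M : Type*} [AddCommGroup M] [Module k M] {N : Type*} [AddCommGroup N] [Module k N]

/-- A morphism of Yetter-Drinfeld modules: a linear and colinear map. -/
structure IsHom (X : YDModule k H M) (Y : YDModule k H N) (f : M →ₗ[k] N) : Prop where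
  map_act : ∀ (h : H) (m : M), f (X.act h m) = Y.act h (f m)
  map_coact : ∀ m : M, f.lTensor H (X.coact m) = Y.coact (f m)

/-- The action as a map `H ⊗ M → M`. -/
def actMap (X : YDModule k H M) : H ⊗[k] M →ₗ[k] M := TensorProduct.lift X.act.toLinearMap

/-- The braiding `c(m ⊗ n) = m₍₋₁₎ · n ⊗ m₍₀₎`. -/
def braiding (X : YDModule k H M) (Y : YDModule k H N) : M ⊗[k] N →ₗ[k] N ⊗[k] M :=
  Y.actMap.rTensor M ∘ₗ (TensorProduct.assoc k H N M).symm.toLinearMap ∘ₗ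
    (TensorProduct.comm k M N).toLinearMap.lTensor H ∘ₗ
      (TensorProduct.assoc k H M N).toLinearMap ∘ₗ X.coact.rTensor N

/-- The diagonal action `h · (m ⊗ n) = h₍₁₎ · m ⊗ h₍₂₎ · n` on the tensor product. -/
def tensorAct (X : YDModule k H M) (Y : YDModule k H N) : H →ₐ[k] Module.End k (M ⊗[k] N) :=
  (Module.endTensorEndAlgHom (R := k) (S := k) (A := k) (M := M) (N := N)).comp
    ((Algebra.TensorProduct.map X.act Y.act).comp (Bialgebra.comulAlgHom k H))

/-- The codiagonal coaction `m ⊗ n ↦ m₍₋₁₎ n₍₋₁₎ ⊗ (m₍₀₎ ⊗ n₍₀₎)` on the tensor product. -/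
def tensorCoact (X : YDModule k H M) (Y : YDModule k H N) :
    M ⊗[k] N →ₗ[k] H ⊗[k] (M ⊗[k] N) :=
  (LinearMap.mul' k H).rTensor (M ⊗[k] N) ∘ₗ
    (TensorProduct.tensorTensorTensorComm k H M H N).toLinearMap ∘ₗ
      TensorProduct.map X.coact Y.coact

end YDModule

/-! ### Braided Hopf algebras and Nichols algebras -/

/-- A Hopf algebra `R` in the braided monoidal category of left Yetter-Drinfeld modules over `H`.
All structure maps (multiplication, unit, comultiplication, counit, antipode) are morphisms
of Yetter-Drinfeld modules. -/
structure BraidedHopfAlgebra (k : Type u) [Field k] (H : Type v) [Ring H] [HopfAlgebra k H]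
    (R : Type w) [Ring R] [Algebra k R] extends YDModule k H R where
  comul : R →ₗ[k] R ⊗[k] R
  counit : R →ₐ[k] k
  antipode : R →ₗ[k] R
  -- multiplication and unit are morphisms
  act_mul : ∀ (h : H) (z : R ⊗[k] R), act h (LinearMap.mul' k R z) =
    LinearMap.mul' k R (toYDModule.tensorAct toYDModule h z)
  act_one : ∀ h : H, act h 1 = Coalgebra.counit (R := k) h • (1 : R)
  coact_mul : ∀ r s : R, coact (r * s) = coact r * coact s
  coact_one : coact 1 = 1
  -- coalgebra axioms
  comul_coassoc : (TensorProduct.assoc k R R R).toLinearMap ∘ₗ comul.rTensor R ∘ₗ comul =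
    comul.lTensor R ∘ₗ comul
  counit_left : ∀ r : R, TensorProduct.lid k R (counit.toLinearMap.rTensor R (comul r)) = r
  counit_right : ∀ r : R, TensorProduct.rid k R (counit.toLinearMap.lTensor R (comul r)) = r
  -- comultiplication and counit are morphisms
  comul_act : ∀ (h : H) (r : R), comul (act h r) = toYDModule.tensorAct toYDModule h (comul r)
  comul_coact : ∀ r : R, comul.lTensor H (coact r) =
    toYDModule.tensorCoact toYDModule (comul r)
  counit_act : ∀ (h : H) (r : R), counit (act h r) = Coalgebra.counit (R := k) h * counit r
  counit_coact' : ∀ r : R, counit.toLinearMap.lTensor H (coact r) = (1 : H) ⊗ₜ[k] counit r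
  -- `Δ` is an algebra map into the braided tensor product `R ⊗ R`, whose multiplication is
  -- `(mul ⊗ mul) ∘ (id ⊗ c ⊗ id)`
  comul_one : comul 1 = 1 ⊗ₜ[k] 1
  comul_mul : ∀ r s : R, comul (r * s) =
    (TensorProduct.map (LinearMap.mul' k R) (LinearMap.mul' k R) ∘ₗ
      (TensorProduct.assoc k R R (R ⊗[k] R)).symm.toLinearMap ∘ₗ
        ((TensorProduct.assoc k R R R).toLinearMap ∘ₗ
          (toYDModule.braiding toYDModule).rTensor R ∘ₗ
            (TensorProduct.assoc k R R R).symm.toLinearMap).lTensor R ∘ₗ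
          (TensorProduct.assoc k R R (R ⊗[k] R)).toLinearMap) (comul r ⊗ₜ[k] comul s)
  -- the antipode
  antipode_isHom : toYDModule.IsHom toYDModule antipode
  antipode_left : ∀ r : R, LinearMap.mul' k R (antipode.rTensor R (comul r)) =
    algebraMap k R (counit r)
  antipode_right : ∀ r : R, LinearMap.mul' k R (antipode.lTensor R (comul r)) =
    algebraMap k R (counit r)

/-- The Nichols algebra of a Yetter-Drinfeld module `V`: a braided `ℕ`-graded Hopf algebra
`R = ⨁ R(n)` such that `R(0) ≃ k`, `R(1) ≃ V` (as Yetter-Drinfeld modules, through `ι`), `R(1)` is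
the space of primitive elements of `R`, and `R` is generated as an algebra by `R(1)`. -/
structure NicholsAlgebra {k : Type u} [Field k] {H : Type v} [Ring H] [HopfAlgebra k H]
    {V : Type*} [AddCommGroup V] [Module k V] (X : YDModule k H V)
    (R : Type w) [Ring R] [Algebra k R] extends BraidedHopfAlgebra k H R where
  grading : ℕ → Submodule k R
  gradedMonoid : SetLike.GradedMonoid grading
  isInternal : DirectSum.IsInternal grading
  act_mem : ∀ (n : ℕ) (h : H) (r : R), r ∈ grading n → act h r ∈ grading n
  coact_mem : ∀ (n : ℕ) (r : R), r ∈ grading n →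
    coact r ∈ LinearMap.range ((grading n).subtype.lTensor H)
  comul_mem : ∀ (n : ℕ) (r : R), r ∈ grading n →
    comul r ∈ ⨆ p ∈ Finset.HasAntidiagonal.antidiagonal n,
      LinearMap.range (TensorProduct.map (grading p.1).subtype (grading p.2).subtype)
  counit_mem : ∀ (n : ℕ) (r : R), n ≠ 0 → r ∈ grading n → counit r = 0
  antipode_mem : ∀ (n : ℕ) (r : R), r ∈ grading n → antipode r ∈ grading n
  finrank_zero : Module.finrank k (grading 0) = 1
  ι : V →ₗ[k] R
  ι_isHom : X.IsHom toYDModule ι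
  ι_injective : Function.Injective ι
  range_ι : LinearMap.range ι = grading 1
  primitive_iff : ∀ r : R, r ∈ grading 1 ↔ comul r = r ⊗ₜ[k] 1 + 1 ⊗ₜ[k] r
  adjoin_eq_top : Algebra.adjoin k (grading 1 : Set R) = ⊤

end YetterDrinfeld

/-! ### The eight-dimensional Hopf algebra `𝒦` -/

section HopfK

variable {k : Type u} [Field k]

/-- Names of the generators `a, b, c, d` of `𝒦`. -/
inductive KGen : Type
  | a | b | c | d

/-- The defining relations of `𝒦`. -/
inductive KRel (ξ : k) : FreeAlgebra k KGen → FreeAlgebra k KGen → Prop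
  | ab : KRel ξ (FreeAlgebra.ι k .a * FreeAlgebra.ι k .b)
      (ξ • (FreeAlgebra.ι k .b * FreeAlgebra.ι k .a))
  | ac : KRel ξ (FreeAlgebra.ι k .a * FreeAlgebra.ι k .c)
      (ξ • (FreeAlgebra.ι k .c * FreeAlgebra.ι k .a))
  | cb : KRel ξ (FreeAlgebra.ι k .c * FreeAlgebra.ι k .b) 0
  | bc : KRel ξ (FreeAlgebra.ι k .b * FreeAlgebra.ι k .c) 0
  | cd : KRel ξ (FreeAlgebra.ι k .c * FreeAlgebra.ι k .d)
      (ξ • (FreeAlgebra.ι k .d * FreeAlgebra.ι k .c))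
  | bd : KRel ξ (FreeAlgebra.ι k .b * FreeAlgebra.ι k .d)
      (ξ • (FreeAlgebra.ι k .d * FreeAlgebra.ι k .b))
  | da : KRel ξ (FreeAlgebra.ι k .d * FreeAlgebra.ι k .a) 1
  | ad : KRel ξ (FreeAlgebra.ι k .a * FreeAlgebra.ι k .d) 1
  | bb : KRel ξ (FreeAlgebra.ι k .b * FreeAlgebra.ι k .b) 0
  | cc : KRel ξ (FreeAlgebra.ι k .c * FreeAlgebra.ι k .c) 0
  | aac : KRel ξ (FreeAlgebra.ι k .a * FreeAlgebra.ι k .a * FreeAlgebra.ι k .c)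
      (FreeAlgebra.ι k .b)
  | aaaa : KRel ξ (FreeAlgebra.ι k .a ^ 4) 1

/-- The algebra `𝒦` attached to a primitive fourth root of unity `ξ`, presented by the generators
`a, b, c, d` and the relations `KRel`. -/
def HopfK {ξ : k} (_hξ : IsPrimitiveRoot ξ 4) : Type u := RingQuot (KRel ξ)

namespace HopfK

theorem xi_mul_xi {ξ : k} (hξ : IsPrimitiveRoot ξ 4) : ξ * ξ = -1 := by
  have h4 : ξ ^ 4 = 1 := hξ.pow_eq_one
  have h2 : ξ ^ 2 ≠ 1 := hξ.pow_ne_one_of_pos_of_lt (by norm_num) (by norm_num)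
  have h : (ξ ^ 2 - 1) * (ξ * ξ + 1) = 0 := by linear_combination h4
  rcases mul_eq_zero.mp h with h | h
  · exact absurd (sub_eq_zero.mp h) h2
  · linear_combination h

variable {ξ : k} (hξ : IsPrimitiveRoot ξ 4)

instance : Ring (HopfK hξ) := inferInstanceAs (Ring (RingQuot (KRel ξ)))

instance : Algebra k (HopfK hξ) := inferInstanceAs (Algebra k (RingQuot (KRel ξ)))

/-- The generators of `𝒦`. -/
def gen (i : KGen) : HopfK hξ := RingQuot.mkAlgHom k (KRel ξ) (FreeAlgebra.ι k i)

/-- Four elements `α, β, γ, δ` of an algebra satisfying the relations of `𝒦`. -/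
structure IsRep {A : Type*} [Ring A] [Algebra k A] (ξ : k) (α β γ δ : A) : Prop where
  ab : α * β = ξ • (β * α)
  ac : α * γ = ξ • (γ * α)
  cb : γ * β = 0
  bc : β * γ = 0
  cd : γ * δ = ξ • (δ * γ)
  bd : β * δ = ξ • (δ * β)
  da : δ * α = 1
  ad : α * δ = 1
  bb : β * β = 0
  cc : γ * γ = 0
  aac : α * α * γ = β
  aaaa : α * α * (α * α) = 1

theorem isRep_gen : IsRep ξ (gen hξ .a) (gen hξ .b) (gen hξ .c) (gen hξ .d) := by
  have h : ∀ {x y}, KRel ξ x y → RingQuot.mkAlgHom k (KRel ξ) x = RingQuot.mkAlgHom k (KRel ξ) y :=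
    fun r => RingQuot.mkAlgHom_rel k r
  constructor
  · have := h (.ab (ξ := ξ)); rwa [map_mul, map_smul, map_mul] at this
  · have := h (.ac (ξ := ξ)); rwa [map_mul, map_smul, map_mul] at this
  · have := h (.cb (ξ := ξ)); rwa [map_mul, map_zero] at this
  · have := h (.bc (ξ := ξ)); rwa [map_mul, map_zero] at this
  · have := h (.cd (ξ := ξ)); rwa [map_mul, map_smul, map_mul] at this
  · have := h (.bd (ξ := ξ)); rwa [map_mul, map_smul, map_mul] at this
  · have := h (.da (ξ := ξ)); rwa [map_mul, map_one] at this
  · have := h (.ad (ξ := ξ)); rwa [map_mul, map_one] at this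
  · have := h (.bb (ξ := ξ)); rwa [map_mul, map_zero] at this
  · have := h (.cc (ξ := ξ)); rwa [map_mul, map_zero] at this
  · have := h (.aac (ξ := ξ)); rwa [map_mul, map_mul] at this
  · have := h (.aaaa (ξ := ξ))
    rw [map_pow, map_one, show 4 = 2 + 2 from rfl, pow_add, pow_two] at this
    exact this

section Lift

variable {A : Type*} [Ring A] [Algebra k A]

/-- Choice of one of four elements by a generator's name. -/
def pick {A : Type*} (α β γ δ : A) : KGen → A
  | .a => α
  | .b => β
  | .c => γ
  | .d => δ

/-- The universal property of `𝒦`. -/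
def lift {α β γ δ : A} (h : IsRep ξ α β γ δ) : HopfK hξ →ₐ[k] A :=
  RingQuot.liftAlgHom k ⟨FreeAlgebra.lift k (pick α β γ δ), by
    intro x y r
    cases r <;> simp only [map_mul, map_smul, map_one, map_zero, map_pow, FreeAlgebra.lift_ι_apply,
      pick]
    exacts [h.ab, h.ac, h.cb, h.bc, h.cd, h.bd, h.da, h.ad, h.bb, h.cc, h.aac,
      by rw [show 4 = 2 + 2 from rfl, pow_add, pow_two]; exact h.aaaa]⟩

theorem lift_gen {α β γ δ : A} (h : IsRep ξ α β γ δ) (i : KGen) :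
    lift hξ h (gen hξ i) = pick α β γ δ i := by
  unfold lift gen
  erw [RingQuot.liftAlgHom_mkAlgHom_apply]
  simp

@[ext] theorem algHom_ext {f g : HopfK hξ →ₐ[k] A}
    (h : ∀ i, f (gen hξ i) = g (gen hξ i)) : f = g := by
  apply RingQuot.ringQuot_ext' k (s := KRel ξ)
  ext i
  exact h i

end Lift

theorem induction {P : HopfK hξ → Prop} (algebraMap : ∀ r : k, P (algebraMap k _ r))
    (gen : ∀ i, P (gen hξ i)) (mul : ∀ x y, P x → P y → P (x * y))
    (add : ∀ x y, P x → P y → P (x + y)) (x : HopfK hξ) : P x := by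
  obtain ⟨y, rfl⟩ := RingQuot.mkAlgHom_surjective k (KRel ξ) x
  induction y using FreeAlgebra.induction with
  | grade0 r => rw [AlgHom.commutes]; exact algebraMap r
  | grade1 i => exact gen i
  | mul x y hx hy => rw [map_mul]; exact mul _ _ hx hy
  | add x y hx hy => rw [map_add]; exact add _ _ hx hy

section Hopf

local notation "𝐚" => gen hξ KGen.a
local notation "𝐛" => gen hξ KGen.b
local notation "𝐜" => gen hξ KGen.c
local notation "𝐝" => gen hξ KGen.d

theorem mul_table : 𝐛 * 𝐚 = (-ξ) • (𝐚 * 𝐛) ∧ 𝐜 * 𝐚 = (-ξ) • (𝐚 * 𝐜) ∧ 𝐝 * 𝐝 = 𝐚 * 𝐚 ∧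
    𝐝 * 𝐛 = 𝐚 * 𝐜 ∧ 𝐝 * 𝐜 = 𝐚 * 𝐛 ∧ 𝐛 * 𝐝 = ξ • (𝐚 * 𝐜) ∧ 𝐜 * 𝐝 = ξ • (𝐚 * 𝐛) ∧
    𝐚 * (𝐚 * 𝐜) = 𝐛 ∧ 𝐚 * (𝐚 * 𝐛) = 𝐜 ∧ 𝐚 * (𝐚 * 𝐚) = 𝐝 := by
  have h := isRep_gen hξ
  have hx := xi_mul_xi hξ
  have h1 : 𝐚 * (𝐚 * 𝐜) = 𝐛 := by rw [← mul_assoc]; exact h.aac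
  have h2 : 𝐚 * (𝐚 * 𝐛) = 𝐜 := by
    rw [← h1]
    calc _ = (𝐚 * 𝐚 * (𝐚 * 𝐚)) * 𝐜 := by noncomm_ring
      _ = _ := by rw [h.aaaa, one_mul]
  have h3 : 𝐚 * (𝐚 * 𝐚) = 𝐝 := by
    calc _ = (𝐝 * 𝐚) * (𝐚 * (𝐚 * 𝐚)) := by rw [h.da, one_mul]
      _ = 𝐝 * (𝐚 * 𝐚 * (𝐚 * 𝐚)) := by noncomm_ring
      _ = _ := by rw [h.aaaa, mul_one]
  have h4 : 𝐝 * 𝐛 = 𝐚 * 𝐜 := by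
    rw [← h1, ← mul_assoc, h.da, one_mul]
  have h5 : 𝐝 * 𝐜 = 𝐚 * 𝐛 := by
    rw [← h2, ← mul_assoc, h.da, one_mul]
  refine ⟨?_, ?_, ?_, h4, h5, ?_, ?_, h1, h2, h3⟩
  · rw [h.ab, smul_smul, neg_mul, hx, neg_neg, one_smul]
  · rw [h.ac, smul_smul, neg_mul, hx, neg_neg, one_smul]
  · nth_rewrite 2 [← h3]
    rw [← mul_assoc, h.da, one_mul]
  · rw [h.bd, h4]
  · rw [h.cd, h5]

theorem isRep_comul : IsRep ξ (𝐚 ⊗ₜ[k] 𝐚 + 𝐛 ⊗ₜ[k] 𝐜) (𝐚 ⊗ₜ[k] 𝐛 + 𝐛 ⊗ₜ[k] 𝐝)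
    (𝐜 ⊗ₜ[k] 𝐚 + 𝐝 ⊗ₜ[k] 𝐜) (𝐜 ⊗ₜ[k] 𝐛 + 𝐝 ⊗ₜ[k] 𝐝) := by
  have h := isRep_gen hξ
  have hx := xi_mul_xi hξ
  obtain ⟨hba, hca, hdd, hdb, hdc, hbd, hcd, haac, haab, haaa⟩ := mul_table hξ
  have haad : 𝐚 * (𝐚 * 𝐝) = 𝐚 := by rw [h.ad, mul_one]
  have hA : (𝐚 ⊗ₜ[k] 𝐚 + 𝐛 ⊗ₜ[k] 𝐜) * (𝐚 ⊗ₜ[k] 𝐚 + 𝐛 ⊗ₜ[k] 𝐜) = (𝐚 * 𝐚) ⊗ₜ[k] (𝐚 * 𝐚) := by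
    simp only [mul_add, add_mul, Algebra.TensorProduct.tmul_mul_tmul, hba, hca, h.bb, h.cc,
      TensorProduct.zero_tmul, TensorProduct.tmul_smul, ← TensorProduct.smul_tmul', smul_smul]
    rw [neg_mul_neg, hx]
    module
  constructor
  case aac =>
    rw [hA]
    simp only [mul_add, Algebra.TensorProduct.tmul_mul_tmul, mul_assoc, haac, haaa, haad]
    exact add_comm _ _
  case aaaa =>
    rw [hA]
    simp only [Algebra.TensorProduct.tmul_mul_tmul, h.aaaa]
    rfl
  all_goals
    simp only [mul_add, add_mul, Algebra.TensorProduct.tmul_mul_tmul, hba, hca, h.bb, h.cc,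
      TensorProduct.zero_tmul, TensorProduct.tmul_zero, TensorProduct.tmul_smul,
      ← TensorProduct.smul_tmul', smul_smul, h.cb, h.bc, h.da, h.ad, hdd, hdb, hdc, hbd, hcd,
      smul_add, add_zero, zero_add, Algebra.TensorProduct.one_def, hx, neg_mul, mul_neg, neg_neg]
  all_goals module

theorem isRep_counit : IsRep ξ (1 : k) 0 0 1 := by
  constructor <;> simp

/-- The comultiplication of `𝒦`. -/
def comulHom : HopfK hξ →ₐ[k] HopfK hξ ⊗[k] HopfK hξ := lift hξ (isRep_comul hξ)

/-- The counit of `𝒦`. -/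
def counitHom : HopfK hξ →ₐ[k] k := lift hξ isRep_counit

theorem comulHom_gen (i : KGen) : comulHom hξ (gen hξ i) =
    pick (𝐚 ⊗ₜ[k] 𝐚 + 𝐛 ⊗ₜ[k] 𝐜) (𝐚 ⊗ₜ[k] 𝐛 + 𝐛 ⊗ₜ[k] 𝐝)
      (𝐜 ⊗ₜ[k] 𝐚 + 𝐝 ⊗ₜ[k] 𝐜) (𝐜 ⊗ₜ[k] 𝐛 + 𝐝 ⊗ₜ[k] 𝐝) i :=
  lift_gen hξ _ i

theorem counitHom_gen (i : KGen) : counitHom hξ (gen hξ i) = pick 1 0 0 1 i :=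
  lift_gen hξ _ i

instance : Bialgebra k (HopfK hξ) :=
  Bialgebra.ofAlgHom (comulHom hξ) (counitHom hξ)
    (by
      ext i
      cases i <;> simp [comulHom_gen, pick, TensorProduct.add_tmul, TensorProduct.tmul_add] <;> abel)
    (by
      ext i
      cases i <;> simp [comulHom_gen, counitHom_gen, pick])
    (by
      ext i
      cases i <;> simp [comulHom_gen, counitHom_gen, pick])

theorem comul_gen (i : KGen) : Coalgebra.comul (R := k) (gen hξ i) =
    pick (𝐚 ⊗ₜ[k] 𝐚 + 𝐛 ⊗ₜ[k] 𝐜) (𝐚 ⊗ₜ[k] 𝐛 + 𝐛 ⊗ₜ[k] 𝐝)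
      (𝐜 ⊗ₜ[k] 𝐚 + 𝐝 ⊗ₜ[k] 𝐜) (𝐜 ⊗ₜ[k] 𝐛 + 𝐝 ⊗ₜ[k] 𝐝) i :=
  comulHom_gen hξ i

theorem counit_gen (i : KGen) : Coalgebra.counit (R := k) (gen hξ i) = pick 1 0 0 1 i :=
  counitHom_gen hξ i

open MulOpposite in
theorem isRep_antipode : IsRep ξ (op 𝐝) (op (ξ • 𝐛)) (op (-ξ • 𝐜)) (op 𝐚) := by
  have h := isRep_gen hξ
  have hx := xi_mul_xi hξ
  obtain ⟨hba, hca, hdd, hdb, hdc, hbd, hcd, haac, haab, haaa⟩ := mul_table hξ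
  have hcaa : 𝐜 * (𝐚 * 𝐚) = -𝐛 := by
    rw [← mul_assoc, hca, smul_mul_assoc, mul_assoc, hca, mul_smul_comm, haac, smul_smul,
      neg_mul_neg, hx, neg_one_smul]
  constructor <;> apply unop_injective <;>
    simp only [unop_mul, unop_op, unop_smul, unop_one, unop_zero, mul_smul_comm, smul_mul_assoc,
      smul_smul, hba, hca, h.bb, h.cc, h.cb, h.bc, h.da, h.ad, hdd, hdb, hdc, hbd, hcd, hcaa, hx,
      smul_zero, neg_mul, mul_neg, neg_neg, neg_smul, smul_neg, h.aaaa, neg_zero, mul_one]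

/-- The antipode of `𝒦`, as an algebra map to the opposite algebra. -/
def antipodeHom : HopfK hξ →ₐ[k] (HopfK hξ)ᵐᵒᵖ := lift hξ (isRep_antipode hξ)

/-- The antipode of `𝒦`, as a linear map. -/
def antipodeLin : HopfK hξ →ₗ[k] HopfK hξ :=
  (MulOpposite.opLinearEquiv k).symm.toLinearMap ∘ₗ (antipodeHom hξ).toLinearMap

theorem antipodeLin_gen (i : KGen) :
    antipodeLin hξ (gen hξ i) = pick 𝐝 (ξ • 𝐛) (-ξ • 𝐜) 𝐚 i := by
  have := congrArg MulOpposite.unop (lift_gen hξ (isRep_antipode hξ) i)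
  cases i <;> exact this

theorem antipodeLin_mul (x y : HopfK hξ) :
    antipodeLin hξ (x * y) = antipodeLin hξ y * antipodeLin hξ x := by
  simp [antipodeLin]

theorem antipodeLin_algebraMap (r : k) :
    antipodeLin hξ (algebraMap k _ r) = algebraMap k _ r := by
  simp [antipodeLin]

open Coalgebra in
theorem antipode_left (x : HopfK hξ) : LinearMap.mul' k (HopfK hξ)
    ((antipodeLin hξ).rTensor _ (comul (R := k) x)) = algebraMap k _ (counit (R := k) x) := by
  have h := isRep_gen hξ
  have hx := xi_mul_xi hξ
  obtain ⟨hba, hca, hdd, hdb, hdc, hbd, hcd, haac, haab, haaa⟩ := mul_table hξ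
  induction x using HopfK.induction with
  | algebraMap r =>
    simp [Algebra.TensorProduct.algebraMap_apply, antipodeLin_algebraMap]
  | gen i =>
    rw [comul_gen, counit_gen]
    cases i <;> simp [pick, antipodeLin_gen, h.da, h.ad, h.bc, h.cb, hdb, hbd, hca,
      smul_smul, hx]
  | mul x y hX hY =>
    have e : ∀ s t : HopfK hξ ⊗[k] HopfK hξ, LinearMap.mul' k (HopfK hξ)
        ((antipodeLin hξ).rTensor _ s) = algebraMap k _ (counit (R := k) x) →
        LinearMap.mul' k (HopfK hξ) ((antipodeLin hξ).rTensor _ (s * t)) =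
          counit (R := k) x • LinearMap.mul' k (HopfK hξ) ((antipodeLin hξ).rTensor _ t) := by
      intro s t hs
      induction t with
      | zero => simp
      | add t u ht hu => simp only [mul_add, map_add, ht, hu, smul_add]
      | tmul y₁ y₂ =>
        have : ∀ s : HopfK hξ ⊗[k] HopfK hξ, LinearMap.mul' k (HopfK hξ)
            ((antipodeLin hξ).rTensor _ (s * (y₁ ⊗ₜ y₂))) =
            antipodeLin hξ y₁ * LinearMap.mul' k (HopfK hξ) ((antipodeLin hξ).rTensor _ s) * y₂ := by
          intro s
          induction s with
          | zero => simp
          | add s u hs hu => simp only [add_mul, mul_add, map_add, hs, hu]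
          | tmul x₁ x₂ => simp [antipodeLin_mul, mul_assoc]
        rw [this, hs]
        simp [Algebra.algebraMap_eq_smul_one]
    rw [Bialgebra.comul_mul, e _ _ hX, hY, Bialgebra.counit_mul, map_mul, Algebra.smul_def]
  | add x y hX hY => simp only [map_add, hX, hY]

open Coalgebra in
theorem antipode_right (x : HopfK hξ) : LinearMap.mul' k (HopfK hξ)
    ((antipodeLin hξ).lTensor _ (comul (R := k) x)) = algebraMap k _ (counit (R := k) x) := by
  have h := isRep_gen hξ
  have hx := xi_mul_xi hξ
  obtain ⟨hba, hca, hdd, hdb, hdc, hbd, hcd, haac, haab, haaa⟩ := mul_table hξ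
  induction x using HopfK.induction with
  | algebraMap r =>
    have h1 : antipodeLin hξ 1 = 1 := by simpa using antipodeLin_algebraMap hξ 1
    simp [Algebra.TensorProduct.algebraMap_apply, h1]
  | gen i =>
    rw [comul_gen, counit_gen]
    cases i <;> simp [pick, antipodeLin_gen, h.da, h.ad, h.bc, h.cb, hba, hdc, hcd]
  | mul x y hX hY =>
    have e : ∀ s t : HopfK hξ ⊗[k] HopfK hξ, LinearMap.mul' k (HopfK hξ)
        ((antipodeLin hξ).lTensor _ t) = algebraMap k _ (counit (R := k) y) →
        LinearMap.mul' k (HopfK hξ) ((antipodeLin hξ).lTensor _ (s * t)) =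
          counit (R := k) y • LinearMap.mul' k (HopfK hξ) ((antipodeLin hξ).lTensor _ s) := by
      intro s t ht
      induction s with
      | zero => simp
      | add s u hs hu => simp only [add_mul, map_add, hs, hu, smul_add]
      | tmul x₁ x₂ =>
        have : ∀ t : HopfK hξ ⊗[k] HopfK hξ, LinearMap.mul' k (HopfK hξ)
            ((antipodeLin hξ).lTensor _ ((x₁ ⊗ₜ x₂) * t)) =
            x₁ * LinearMap.mul' k (HopfK hξ) ((antipodeLin hξ).lTensor _ t) * antipodeLin hξ x₂ := by
          intro t
          induction t with
          | zero => simp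
          | add s u hs hu => simp only [add_mul, mul_add, map_add, hs, hu]
          | tmul y₁ y₂ => simp [antipodeLin_mul, mul_assoc]
        rw [this, ht]
        simp [Algebra.algebraMap_eq_smul_one]
    rw [Bialgebra.comul_mul, e _ _ hY, hX, Bialgebra.counit_mul, mul_comm, map_mul,
      Algebra.smul_def]
  | add x y hX hY => simp only [map_add, hX, hY]

instance : HopfAlgebra k (HopfK hξ) where
  antipode := antipodeLin hξ
  mul_antipode_rTensor_comul := LinearMap.ext (antipode_left hξ)
  mul_antipode_lTensor_comul := LinearMap.ext (antipode_right hξ)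

end Hopf

end HopfK

end HopfK

/-! ### The Yetter-Drinfeld module `V_{2,3}` -/

section V23

variable {k : Type u} [Field k] {ξ : k} (hξ : IsPrimitiveRoot ξ 4)

namespace HopfK

theorem antipode_gen (i : KGen) : HopfAlgebra.antipode k (gen hξ i) =
    pick (gen hξ .d) (ξ • gen hξ .b) (-ξ • gen hξ .c) (gen hξ .a) i :=
  antipodeLin_gen hξ i

theorem isRep_matrix {ξ : k} (hξ : IsPrimitiveRoot ξ 4) :
    IsRep ξ (!![-1, 0; 0, ξ] : Matrix (Fin 2) (Fin 2) k) !![0, 1; 0, 0] !![0, 1; 0, 0]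
      !![-1, 0; 0, -ξ] := by
  have hx := xi_mul_xi hξ
  constructor <;> ext i j <;> fin_cases i <;> fin_cases j <;>
    simp [Matrix.mul_apply, Fin.sum_univ_two, hx]

/-- The action of `𝒦` on `V_{2,3} = k e₁ ⊕ k e₂`: `a`, `b`, `c`, `d` act in the basis `e₁, e₂` by
the matrices with columns `a e₁ = -e₁`, `a e₂ = ξ e₂`, `b e₁ = 0`, `b e₂ = e₁`, `c e₁ = 0`,
`c e₂ = e₁`, `d e₁ = -e₁`, `d e₂ = -ξ e₂`. -/
def v23Act : HopfK hξ →ₐ[k] Module.End k (Fin 2 → k) :=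
  (Matrix.toLinAlgEquiv' (R := k) (n := Fin 2)).toAlgHom.comp (lift hξ (isRep_matrix hξ))

/-- The coaction of `𝒦` on `V_{2,3}`: `δ(e₁) = a ⊗ e₁ - (1 + ξ) b ⊗ e₂` and
`δ(e₂) = d ⊗ e₂ + ½(ξ - 1) c ⊗ e₁`. -/
def v23Coact : (Fin 2 → k) →ₗ[k] HopfK hξ ⊗[k] (Fin 2 → k) :=
  (Pi.basisFun k (Fin 2)).constr k
    ![gen hξ .a ⊗ₜ Pi.single 0 1 - (1 + ξ) • (gen hξ .b ⊗ₜ Pi.single 1 1),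
      gen hξ .d ⊗ₜ Pi.single 1 1 + ((ξ - 1) / 2) • (gen hξ .c ⊗ₜ Pi.single 0 1)]

theorem v23Coact_zero : v23Coact hξ (Pi.single 0 1) =
    gen hξ .a ⊗ₜ Pi.single 0 1 - (1 + ξ) • (gen hξ .b ⊗ₜ Pi.single 1 1) := by
  have := (Pi.basisFun k (Fin 2)).constr_basis k
    ![gen hξ .a ⊗ₜ[k] (Pi.single 0 1 : Fin 2 → k) - (1 + ξ) • (gen hξ .b ⊗ₜ Pi.single 1 1),
      gen hξ .d ⊗ₜ Pi.single 1 1 + ((ξ - 1) / 2) • (gen hξ .c ⊗ₜ Pi.single 0 1)] 0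
  rwa [Pi.basisFun_apply] at this

theorem v23Coact_one : v23Coact hξ (Pi.single 1 1) =
    gen hξ .d ⊗ₜ Pi.single 1 1 + ((ξ - 1) / 2) • (gen hξ .c ⊗ₜ Pi.single 0 1) := by
  have := (Pi.basisFun k (Fin 2)).constr_basis k
    ![gen hξ .a ⊗ₜ[k] (Pi.single 0 1 : Fin 2 → k) - (1 + ξ) • (gen hξ .b ⊗ₜ Pi.single 1 1),
      gen hξ .d ⊗ₜ Pi.single 1 1 + ((ξ - 1) / 2) • (gen hξ .c ⊗ₜ Pi.single 0 1)] 1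
  rwa [Pi.basisFun_apply] at this

theorem v23Act_zero (i : KGen) : v23Act hξ (gen hξ i) (Pi.single 0 1) =
    pick (-Pi.single 0 1) 0 0 (-Pi.single 0 1) i := by
  have h : v23Act hξ (gen hξ i) = Matrix.toLin' (lift hξ (isRep_matrix hξ) (gen hξ i)) := rfl
  rw [h, lift_gen]
  cases i <;> ext j <;> fin_cases j <;> simp [pick]

theorem v23Act_one (i : KGen) : v23Act hξ (gen hξ i) (Pi.single 1 1) =
    pick (ξ • Pi.single 1 1) (Pi.single 0 1) (Pi.single 0 1) (-ξ • Pi.single 1 1) i := by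
  have h : v23Act hξ (gen hξ i) = Matrix.toLin' (lift hξ (isRep_matrix hξ) (gen hξ i)) := rfl
  rw [h, lift_gen]
  cases i <;> ext j <;> fin_cases j <;> simp [pick]

theorem hom_ext_two {M : Type*} [AddCommGroup M] [Module k M] {f g : (Fin 2 → k) →ₗ[k] M}
    (h0 : f (Pi.single 0 1) = g (Pi.single 0 1)) (h1 : f (Pi.single 1 1) = g (Pi.single 1 1)) :
    f = g := by
  refine (Pi.basisFun k (Fin 2)).ext fun i => ?_
  rw [Pi.basisFun_apply]
  fin_cases i
  exacts [h0, h1]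

theorem two_ne_zero_of_root {ξ : k} (hξ : IsPrimitiveRoot ξ 4) : (2 : k) ≠ 0 := by
  intro h
  have hx := xi_mul_xi hξ
  have h2 : ξ ^ 2 ≠ 1 := hξ.pow_ne_one_of_pos_of_lt (by norm_num) (by norm_num)
  exact h2 (by linear_combination hx - h)

theorem v23_compat_gen (i : KGen) (v : Fin 2 → k) :
    v23Coact hξ (v23Act hξ (gen hξ i) v) =
      ydTwist k _ (v23Act hξ) (comulThree k _ (gen hξ i)) (v23Coact hξ v) := by
  have h := isRep_gen hξ
  have hx := xi_mul_xi hξ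
  have h2 := two_ne_zero_of_root hξ
  obtain ⟨hba, hca, hdd, hdb, hdc, hbd, hcd, haac, haab, haaa⟩ := mul_table hξ
  have hdaa : gen hξ .d * (gen hξ .a * gen hξ .a) = gen hξ .a := by rw [← mul_assoc, h.da, one_mul]
  have hdab : gen hξ .d * (gen hξ .a * gen hξ .b) = gen hξ .b := by rw [← mul_assoc, h.da, one_mul]
  have hdac : gen hξ .d * (gen hξ .a * gen hξ .c) = gen hξ .c := by rw [← mul_assoc, h.da, one_mul]
  have hbac : gen hξ .b * (gen hξ .a * gen hξ .c) = 0 := by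
    rw [← mul_assoc, hba, smul_mul_assoc, mul_assoc, h.bc, mul_zero, smul_zero]
  have hbab : gen hξ .b * (gen hξ .a * gen hξ .b) = 0 := by
    rw [← mul_assoc, hba, smul_mul_assoc, mul_assoc, h.bb, mul_zero, smul_zero]
  have hcac : gen hξ .c * (gen hξ .a * gen hξ .c) = 0 := by
    rw [← mul_assoc, hca, smul_mul_assoc, mul_assoc, h.cc, mul_zero, smul_zero]
  have hcab : gen hξ .c * (gen hξ .a * gen hξ .b) = 0 := by
    rw [← mul_assoc, hca, smul_mul_assoc, mul_assoc, h.cb, mul_zero, smul_zero]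
  have hbaa : gen hξ .b * (gen hξ .a * gen hξ .a) = -gen hξ .c := by
    rw [← mul_assoc, hba, smul_mul_assoc, mul_assoc, hba, mul_smul_comm, haab, smul_smul,
      neg_mul_neg, hx, neg_one_smul]
  have hcaa : gen hξ .c * (gen hξ .a * gen hξ .a) = -gen hξ .b := by
    rw [← mul_assoc, hca, smul_mul_assoc, mul_assoc, hca, mul_smul_comm, haac, smul_smul,
      neg_mul_neg, hx, neg_one_smul]
  suffices v23Coact hξ ∘ₗ v23Act hξ (gen hξ i) =
      ydTwist k _ (v23Act hξ) (comulThree k _ (gen hξ i)) ∘ₗ v23Coact hξ from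
    LinearMap.congr_fun this v
  apply hom_ext_two <;> cases i
  all_goals
    simp only [LinearMap.comp_apply, comulThree, AlgHom.comp_apply, Bialgebra.comulAlgHom_apply,
      comul_gen, pick, v23Act_zero, v23Act_one, v23Coact_zero, v23Coact_one, map_add, map_sub,
      map_smul, map_neg, map_zero, Algebra.TensorProduct.map_tmul, AlgHom.id_apply,
      TensorProduct.tmul_add, LinearMap.add_apply, ydTwist_tmul, antipode_gen]
  all_goals
    simp only [TensorProduct.tmul_zero, TensorProduct.tmul_neg, TensorProduct.tmul_smul,
      mul_smul_comm, ← TensorProduct.smul_tmul', smul_smul, h.da, h.ad, h.bc, h.cb, h.bb, h.cc, hba,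
      hca, hdd, hdb, hdc, hbd, hcd, haac, haab, haaa, mul_zero, TensorProduct.zero_tmul, smul_zero,
      add_zero, zero_add, mul_one, hbac, hbab, hcab, hcac, hbaa, hcaa, hdac, hdab, hdaa,
      TensorProduct.neg_tmul, neg_zero, neg_mul_neg, hx]
  all_goals match_scalars
  all_goals grind

/-- The Yetter-Drinfeld module `V_{2,3}` over `𝒦`, with basis `e₁ = Pi.single 0 1` and
`e₂ = Pi.single 1 1`. -/
def v23 : YDModule k (HopfK hξ) (Fin 2 → k) where
  act := v23Act hξ
  coact := v23Coact hξ
  coassoc := by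
    have hx := xi_mul_xi hξ
    have h2 := two_ne_zero_of_root hξ
    apply hom_ext_two
    all_goals
      simp only [LinearMap.comp_apply, v23Coact_zero, v23Coact_one, map_add, map_sub, map_smul,
        LinearMap.rTensor_tmul, LinearMap.lTensor_tmul, comul_gen, pick, TensorProduct.add_tmul,
        TensorProduct.tmul_add, TensorProduct.tmul_sub, TensorProduct.tmul_smul,
        LinearEquiv.coe_coe, TensorProduct.assoc_tmul]
      match_scalars
    all_goals grind
  counit_coact := by
    apply hom_ext_two
    all_goals
      simp [v23Coact_zero, v23Coact_one, counit_gen, pick]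
  compat := by
    intro h
    induction h using HopfK.induction with
    | algebraMap r =>
      intro v
      have h1 : ∀ z, ydTwist k _ (v23Act hξ) (1 : HopfK hξ ⊗[k] (HopfK hξ ⊗[k] HopfK hξ)) z = z := by
        intro z
        induction z with
        | zero => simp
        | add z w hz hw => rw [map_add, hz, hw]
        | tmul m v =>
          rw [Algebra.TensorProduct.one_def, Algebra.TensorProduct.one_def, ydTwist_tmul]
          simp
      rw [Algebra.algebraMap_eq_smul_one, map_smul, map_one, map_smul, map_one, map_smul,
        LinearMap.smul_apply, LinearMap.smul_apply, h1, map_smul, Module.End.one_apply]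
    | gen i => exact v23_compat_gen hξ i
    | mul x y hX hY =>
      intro v
      rw [map_mul, map_mul, Module.End.mul_apply, hX, hY, ydTwist_mul]
    | add x y hX hY =>
      intro v
      simp only [map_add, LinearMap.add_apply, hX, hY]

end HopfK

end V23

/-! ### The presented algebra -/

section Presentation

variable {k : Type u} [Field k]

/-- The relations `x² = 0`, `xy - ξ yx = 0`, `y⁴ = 0` on the free algebra on `x = ι 0`, `y = ι 1`. -/
inductive PlaneRel (ξ : k) : FreeAlgebra k (Fin 2) → FreeAlgebra k (Fin 2) → Prop
  | xx : PlaneRel ξ (FreeAlgebra.ι k 0 ^ 2) 0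
  | xy : PlaneRel ξ (FreeAlgebra.ι k 0 * FreeAlgebra.ι k 1 -
      ξ • (FreeAlgebra.ι k 1 * FreeAlgebra.ι k 0)) 0
  | yyyy : PlaneRel ξ (FreeAlgebra.ι k 1 ^ 4) 0

/-- The algebra generated by `x, y` subject to `x² = 0`, `xy - ξ yx = 0`, `y⁴ = 0`. -/
abbrev PlaneAlg (ξ : k) : Type u := RingQuot (PlaneRel ξ)

/-- The generators `x = planeGen ξ 0` and `y = planeGen ξ 1` of `PlaneAlg ξ`. -/
def planeGen (ξ : k) (i : Fin 2) : PlaneAlg ξ :=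
  RingQuot.mkAlgHom k (PlaneRel ξ) (FreeAlgebra.ι k i)

end Presentation

end

/-! Both halves of the theorem, existence and uniqueness, rest on one table: the coproducts of the
eight words yⁱ and yⁱx with i ≤ 3 (`comulTable`). It is computed from the action and coaction on x
and y alone, in any algebra R with operators behaving like a, b, c, d on words (`IsWordAct`), so the
same computation serves the presented algebra A and an arbitrary Nichols algebra.

Existence. The regular representation shows that the words form a basis of A. The coproduct of 𝒦 is
the matrix coproduct on (a b; c d), so operators a, b, c, d obey the product rule h·(rs) =
(h₍₁₎·r)(h₍₂₎·s) exactly when r ↦ (a·r, b·r; c·r, d·r) is multiplicative into 2 × 2 matrices over A.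
The action therefore comes from the universal property of A (`isPlanePair_matrix`, `yyyy_matrix`),
and the coaction likewise, as an algebra map to 𝒦 ⊗ A. The comultiplication is prescribed by the
table. Since the braided tensor square is associative (`braidedMul_assoc`), Δ is multiplicative as
soon as it respects left multiplication by x and y (`comul_mul`). Most of the remaining axioms are
finite checks on words, for the generators of 𝒦 where 𝒦 acts.

That all primitives lie in degree one uses the skew derivations ∂x = (id ⊗ x*)Δ and ∂y = (id ⊗ y*)Δ.
Each coordinate of an element is, up to a nonzero quantum factorial at q = -ξ, the counit of an
iterated derivative (`counit_deriv`). The first derivatives of a primitive element are scalars, so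
only its coordinates at x and y survive.

Uniqueness. In a Nichols algebra R, a primitive element that is homogeneous of degree other than one
is zero. The elements x² and xy - ξyx are primitive of degree two, hence vanish; given this, y⁴ is
primitive of degree four and vanishes too. So there is an algebra map A → R, surjective because R(1)
generates R. It respects Δ and ε, so its kernel is killed by ε and stable under ∂x and ∂y; all
coordinates of a kernel element are then zero (`eq_zero_of_mem_of_deriv_mem`,
`injective_of_map_gen`). -/

noncomputable section

set_option linter.unusedSimpArgs false

/-! ### Algebras in Yetter-Drinfeld modules and their braided tensor square -/

namespace YDModule

variable {k : Type u} [Field k] {H : Type v} [Ring H] [HopfAlgebra k H]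
variable {R : Type w} [Ring R] [Algebra k R]

/-- The multiplication and the unit of `R` are morphisms of Yetter-Drinfeld modules. -/
structure IsAlgebra (X : YDModule k H R) : Prop where
  act_mul : ∀ (h : H) (z : R ⊗[k] R), X.act h (LinearMap.mul' k R z) =
    LinearMap.mul' k R (X.tensorAct X h z)
  act_one : ∀ h : H, X.act h 1 = Coalgebra.counit (R := k) h • (1 : R)
  coact_mul : ∀ r s : R, X.coact (r * s) = X.coact r * X.coact s
  coact_one : X.coact 1 = 1

/-- The multiplication `(mul ⊗ mul) ∘ (id ⊗ c ⊗ id)` of the braided tensor square of `R`. -/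
def braidedMul (X : YDModule k H R) : (R ⊗[k] R) ⊗[k] (R ⊗[k] R) →ₗ[k] R ⊗[k] R :=
  TensorProduct.map (LinearMap.mul' k R) (LinearMap.mul' k R) ∘ₗ
      (TensorProduct.assoc k R R (R ⊗[k] R)).symm.toLinearMap ∘ₗ
        ((TensorProduct.assoc k R R R).toLinearMap ∘ₗ
          (X.braiding X).rTensor R ∘ₗ
            (TensorProduct.assoc k R R R).symm.toLinearMap).lTensor R ∘ₗ
          (TensorProduct.assoc k R R (R ⊗[k] R)).toLinearMap

theorem braiding_eq (X : YDModule k H R) (r s : R) :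
    X.braiding X (r ⊗ₜ s) = TensorProduct.map (X.act.toLinearMap.flip s) LinearMap.id
      (X.coact r) := by
  simp only [braiding, LinearMap.comp_apply, LinearMap.rTensor_tmul]
  induction X.coact r with
  | zero => simp
  | add z w hz hw => simp only [TensorProduct.add_tmul, map_add, hz, hw]
  | tmul h q => simp [actMap]

/-- The map `h ⊗ q ↦ p (h · s) ⊗ q t`. -/
def braidedMulAux (X : YDModule k H R) (p s t : R) : H ⊗[k] R →ₗ[k] R ⊗[k] R :=
  TensorProduct.map (LinearMap.mulLeft k p ∘ₗ X.act.toLinearMap.flip s) (LinearMap.mulRight k t)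

theorem braidedMulAux_tmul (X : YDModule k H R) (p s t : R) (h : H) (q : R) :
    X.braidedMulAux p s t (h ⊗ₜ q) = (p * X.act h s) ⊗ₜ (q * t) := rfl

theorem braidedMul_tmul (X : YDModule k H R) (p q s t : R) :
    X.braidedMul ((p ⊗ₜ q) ⊗ₜ (s ⊗ₜ t)) = X.braidedMulAux p s t (X.coact q) := by
  simp only [braidedMul, LinearMap.comp_apply, LinearEquiv.coe_coe, TensorProduct.assoc_tmul,
    LinearMap.lTensor_tmul, TensorProduct.assoc_symm_tmul, LinearMap.rTensor_tmul, braiding_eq]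
  induction X.coact q with
  | zero => simp
  | add z w hz hw => simp only [TensorProduct.add_tmul, TensorProduct.tmul_add, map_add, hz, hw]
  | tmul h q => simp [braidedMulAux_tmul]

theorem tensorAct_tmul (X : YDModule k H R) (h : H) (r s : R) :
    X.tensorAct X h (r ⊗ₜ s) = TensorProduct.map (X.act.toLinearMap.flip r)
      (X.act.toLinearMap.flip s) (Coalgebra.comul (R := k) h) := by
  simp only [tensorAct, AlgHom.comp_apply, Bialgebra.comulAlgHom_apply]
  induction Coalgebra.comul (R := k) h with
  | zero => simp
  | add z w hz hw => simp only [map_add, LinearMap.add_apply, hz, hw]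
  | tmul h q => simp [Module.endTensorEndAlgHom_apply]

theorem IsAlgebra.act_mul_tmul {X : YDModule k H R} (hX : X.IsAlgebra) (h : H) (r s : R) :
    X.act h (r * s) = LinearMap.mul' k R (TensorProduct.map (X.act.toLinearMap.flip r)
      (X.act.toLinearMap.flip s) (Coalgebra.comul (R := k) h)) := by
  rw [← tensorAct_tmul, ← hX.act_mul, LinearMap.mul'_apply]

/-- The multiplication of the braided tensor square is associative. -/
theorem IsAlgebra.braidedMul_assoc {X : YDModule k H R} (hX : X.IsAlgebra)
    (u v w : R ⊗[k] R) :
    X.braidedMul (X.braidedMul (u ⊗ₜ v) ⊗ₜ w) = X.braidedMul (u ⊗ₜ X.braidedMul (v ⊗ₜ w)) := by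
  induction u with
  | zero => simp
  | add u u' h h' => simp only [TensorProduct.add_tmul, map_add, h, h']
  | tmul p q =>
  induction v with
  | zero => simp
  | add u u' h h' => simp only [TensorProduct.add_tmul, TensorProduct.tmul_add, map_add, h, h']
  | tmul r s =>
  induction w with
  | zero => simp
  | add u u' h h' => simp only [TensorProduct.tmul_add, map_add, h, h']
  | tmul t e =>
  rw [braidedMul_tmul, braidedMul_tmul]
  -- Both sides equal p (q₍₋₂₎·r)(q₍₋₁₎s₍₋₁₎·t) ⊗ q₍₀₎s₍₀₎e. With z = δ(q), `key` writes the left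
  -- side in this form, as a linear function of (id ⊗ δ)δ(q), using that δ is multiplicative.
  have key : ∀ z : H ⊗[k] (R), X.braidedMul (X.braidedMulAux p r s z ⊗ₜ (t ⊗ₜ e)) =
      TensorProduct.map (LinearMap.mulLeft k p ∘ₗ LinearMap.mul' k R ∘ₗ
        TensorProduct.map (X.act.toLinearMap.flip r) (LinearMap.id)) (LinearMap.mulRight k e)
        ((TensorProduct.assoc k H R R).symm
        ((TensorProduct.map (X.act.toLinearMap.flip t) (LinearMap.id)).lTensor H
          (((LinearMap.mulRight k (X.coact s)).lTensor H) (X.coact.lTensor H z)))) := by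
    intro z
    induction z with
    | zero => simp
    | add u u' h h' => simp only [TensorProduct.add_tmul, map_add, h, h']
    | tmul h q =>
      rw [braidedMulAux_tmul, braidedMul_tmul, hX.coact_mul]
      simp only [LinearMap.lTensor_tmul, LinearMap.mulRight_apply]
      induction X.coact q * X.coact s with
      | zero => simp
      | add u u' h h' => simp only [TensorProduct.tmul_add, map_add, h, h']
      | tmul h' q' => simp [braidedMulAux_tmul, mul_assoc]
  rw [key]
  -- Coassociativity trades (id ⊗ δ)δ(q) for (Δ ⊗ id)δ(q), the form that the right side takes once
  -- q₍₋₁₎ acts on the product r (s₍₋₁₎·t).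
  have hco := LinearMap.congr_fun X.coassoc q
  simp only [LinearMap.comp_apply] at hco
  rw [← hco]
  clear hco key
  generalize X.coact s = w
  induction w with
  | zero => simp
  | add u u' h h' =>
    have hadd : LinearMap.mulRight k (u + u') = LinearMap.mulRight k u + LinearMap.mulRight k u' :=
      LinearMap.ext fun z => mul_add z u u'
    simp only [map_add, TensorProduct.tmul_add, ← h, ← h', hadd, LinearMap.lTensor_add,
      LinearMap.add_apply]
  | tmul g s' =>
  rw [braidedMulAux_tmul, braidedMul_tmul]
  induction X.coact q with
  | zero => simp
  | add u u' h h' => simp only [map_add, h, h']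
  | tmul h q' =>
    rw [braidedMulAux_tmul, hX.act_mul_tmul, LinearMap.rTensor_tmul]
    induction Coalgebra.comul (R := k) h with
    | zero => simp
    | add u u' h h' => simp only [map_add, TensorProduct.add_tmul, mul_add, h, h']
    | tmul h₁ h₂ => simp [mul_assoc]

end YDModule

/-! ### Operators of `𝒦` on words in `x` and `y` -/

namespace HopfK

variable {k : Type u} [Field k] {ξ : k} {R : Type w} [Ring R] [Algebra k R]

/-- Operators `T i` on `R` that act on words in `x` and `y` as the generators of `𝒦` do on words
in the basis of `V_{2,3}`. -/
structure IsWordAct (ξ : k) (T : KGen → Module.End k R) (x y : R) : Prop where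
  act_one : ∀ i, T i 1 = pick 1 0 0 1 i
  act_x : ∀ i, T i x = pick (-x) 0 0 (-x) i
  act_y_mul : ∀ i s, T i (y * s) = pick (ξ • (y * T .a s) + x * T .c s) (ξ • (y * T .b s) + x * T .d s)
    (x * T .a s - ξ • (y * T .c s)) (x * T .b s - ξ • (y * T .d s)) i

/-- Elements `x` and `y` with `x² = 0` and `xy = ξ yx`. -/
structure IsPlanePair (ξ : k) (x y : R) : Prop where
  xx : x * x = 0
  xy : x * y = ξ • (y * x)

namespace IsPlanePair

variable {x y : R} (h : IsPlanePair ξ x y)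

include h

theorem xy_mul (s : R) : x * (y * s) = ξ • (y * (x * s)) := by
  rw [← mul_assoc, h.xy, smul_mul_assoc, mul_assoc]

end IsPlanePair

namespace IsWordAct

variable {T : KGen → Module.End k R} {x y : R} (hT : IsWordAct ξ T x y)

include hT

theorem act_y (i : KGen) : T i y = pick (ξ • y) x x (-ξ • y) i := by
  have := hT.act_y_mul i 1
  rw [mul_one] at this
  rw [this]
  cases i <;> simp [pick, hT.act_one]

variable (hξ : ξ * ξ = -1) (h : IsPlanePair ξ x y)

include h

/-- Here and below, `act_y_mul` strips the leftmost y, so the action on each word follows from that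
on a shorter one; the relations serve only to move x back to the right of y and to drop x². -/
theorem act_yx (i : KGen) : T i (y * x) = pick (-ξ • (y * x)) 0 0 (ξ • (y * x)) i := by
  rw [hT.act_y_mul]
  cases i <;> simp [pick, hT.act_x, h.xx]

include hξ

theorem act_yy (i : KGen) : T i (y * y) =
    pick (-(y * y)) ((1 + ξ) • (y * x)) (-(1 + ξ) • (y * x)) (-(y * y)) i := by
  rw [hT.act_y_mul]
  cases i <;> simp only [pick, hT.act_y, h.xx, h.xy, mul_smul_comm] <;> match_scalars <;> grind

theorem act_yyx (i : KGen) : T i (y * (y * x)) = pick (y * (y * x)) 0 0 (y * (y * x)) i := by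
  rw [hT.act_y_mul]
  cases i <;> simp only [pick, hT.act_yx h, h.xx, h.xy_mul, mul_smul_comm, mul_zero] <;>
    match_scalars <;> grind

theorem act_yyy (i : KGen) : T i (y * (y * y)) = pick (-ξ • (y * (y * y))) (ξ • (y * (y * x)))
    (ξ • (y * (y * x))) (ξ • (y * (y * y))) i := by
  rw [hT.act_y_mul]
  cases i <;> simp only [pick, hT.act_yy hξ h, h.xx, h.xy_mul, h.xy, mul_smul_comm, mul_zero, mul_neg] <;>
    match_scalars <;> grind

theorem act_yyyx (i : KGen) : T i (y * (y * (y * x))) =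
    pick (ξ • (y * (y * (y * x)))) 0 0 (-ξ • (y * (y * (y * x)))) i := by
  rw [hT.act_y_mul]
  cases i <;> simp only [pick, hT.act_yyx hξ h, h.xx, h.xy_mul, mul_smul_comm, mul_zero] <;>
    match_scalars <;> grind

end IsWordAct

/-! ### The comultiplication on words -/

/-- The values `Δ(1), Δ(y), Δ(y²), Δ(y³), Δ(x), Δ(yx), Δ(y²x), Δ(y³x)` of the comultiplication. -/
def comulTable (ξ : k) (x y : R) : Fin 8 → R ⊗[k] R :=
  ![1 ⊗ₜ 1,
    y ⊗ₜ 1 + 1 ⊗ₜ y,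
    (y * y) ⊗ₜ 1 + (1 - ξ) • (y ⊗ₜ y) + ((ξ - 1) / 2) • (x ⊗ₜ x) + 1 ⊗ₜ (y * y),
    (y * (y * y)) ⊗ₜ 1 - ξ • ((y * y) ⊗ₜ y) + ((1 + ξ) / 2) • ((y * x) ⊗ₜ x) - ξ • (y ⊗ₜ (y * y))
      - ((1 + ξ) / 2) • (x ⊗ₜ (y * x)) + 1 ⊗ₜ (y * (y * y)),
    x ⊗ₜ 1 + 1 ⊗ₜ x,
    (y * x) ⊗ₜ 1 - x ⊗ₜ y + y ⊗ₜ x + 1 ⊗ₜ (y * x),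
    (y * (y * x)) ⊗ₜ 1 + (ξ - 1) • ((y * x) ⊗ₜ y) + x ⊗ₜ (y * y) + (y * y) ⊗ₜ x
      + (1 - ξ) • (y ⊗ₜ (y * x)) + 1 ⊗ₜ (y * (y * x)),
    (y * (y * (y * x))) ⊗ₜ 1 + ξ • ((y * (y * x)) ⊗ₜ y) - ξ • ((y * x) ⊗ₜ (y * y))
      - x ⊗ₜ (y * (y * y)) + (y * (y * y)) ⊗ₜ x - ξ • ((y * y) ⊗ₜ (y * x))
      - ξ • (y ⊗ₜ (y * (y * x))) + 1 ⊗ₜ (y * (y * (y * x)))]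

/-- Braided multiplication by `x ⊗ 1 + 1 ⊗ x`. -/
def comulMulX (ξ : k) (T : KGen → Module.End k R) (x y : R) : R ⊗[k] R →ₗ[k] R ⊗[k] R :=
  TensorProduct.map (LinearMap.mulLeft k x) LinearMap.id +
    TensorProduct.map (T .a) (LinearMap.mulLeft k x) -
      (1 + ξ) • TensorProduct.map (T .b) (LinearMap.mulLeft k y)

/-- Braided multiplication by `y ⊗ 1 + 1 ⊗ y`. -/
def comulMulY (ξ : k) (T : KGen → Module.End k R) (x y : R) : R ⊗[k] R →ₗ[k] R ⊗[k] R :=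
  TensorProduct.map (LinearMap.mulLeft k y) LinearMap.id +
    TensorProduct.map (T .d) (LinearMap.mulLeft k y) +
      ((ξ - 1) / 2) • TensorProduct.map (T .c) (LinearMap.mulLeft k x)

theorem comulMulX_tmul (ξ : k) (T : KGen → Module.End k R) (x y r s : R) :
    comulMulX ξ T x y (r ⊗ₜ s) =
      (x * r) ⊗ₜ s + T .a r ⊗ₜ (x * s) - (1 + ξ) • (T .b r ⊗ₜ (y * s)) := rfl

theorem comulMulY_tmul (ξ : k) (T : KGen → Module.End k R) (x y r s : R) :
    comulMulY ξ T x y (r ⊗ₜ s) =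
      (y * r) ⊗ₜ s + T .d r ⊗ₜ (y * s) + ((ξ - 1) / 2) • (T .c r ⊗ₜ (x * s)) := rfl

namespace IsWordAct

variable {T : KGen → Module.End k R} {x y : R} (hT : IsWordAct ξ T x y)
  (hξ : ξ * ξ = -1) (h2 : (2 : k) ≠ 0) (h : IsPlanePair ξ x y)

include hT

/-- The mixed terms x ⊗ x cancel because a·x = -x and b·x = 0. No relation between x and y is
assumed, so the identity can be used to prove x² = 0 in a Nichols algebra. -/
theorem comulMulX_x : comulMulX ξ T x y (comulTable ξ x y 4) = (x * x) ⊗ₜ 1 + 1 ⊗ₜ (x * x) := by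
  simp only [comulTable, Matrix.cons_val, map_add, comulMulX_tmul, hT.act_one, hT.act_x, pick, mul_one,
    TensorProduct.neg_tmul, TensorProduct.zero_tmul]
  match_scalars <;> grind

/-- Both products have mixed part ξ (y ⊗ x) - ξ (x ⊗ y), after the second is scaled by ξ. Again no
relation is assumed. -/
theorem comulMul_xy : comulMulX ξ T x y (comulTable ξ x y 1) -
      ξ • comulMulY ξ T x y (comulTable ξ x y 4) =
    (x * y - ξ • (y * x)) ⊗ₜ 1 + 1 ⊗ₜ (x * y - ξ • (y * x)) := by
  simp only [comulTable, Matrix.cons_val, map_add, comulMulX_tmul, comulMulY_tmul, hT.act_one, hT.act_x,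
    hT.act_y, pick, mul_one, TensorProduct.neg_tmul, TensorProduct.zero_tmul, TensorProduct.sub_tmul,
    TensorProduct.tmul_sub, ← TensorProduct.smul_tmul', TensorProduct.tmul_smul]
  match_scalars <;> grind

include hξ h

/-- The coefficients 1, ξ, -1, -ξ are the powers ξⁱ from x yⁱ = ξⁱ yⁱ x; the zeros come from x² = 0.
-/
theorem comulMulX_table (i : Fin 8) : comulMulX ξ T x y (comulTable ξ x y i) =
    ![comulTable ξ x y 4, ξ • comulTable ξ x y 5, -comulTable ξ x y 6, -ξ • comulTable ξ x y 7,
      0, 0, 0, 0] i := by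
  fin_cases i
  all_goals
    simp only [comulTable, Matrix.cons_val, map_add, map_sub, map_smul, comulMulX_tmul, hT.act_one,
      hT.act_x, hT.act_y, hT.act_yx h, hT.act_yy hξ h, hT.act_yyx hξ h,
      hT.act_yyy hξ h, hT.act_yyyx hξ h, pick, mul_one,
      h.xx, h.xy, h.xy_mul, mul_smul_comm, mul_zero, smul_zero, TensorProduct.tmul_zero,
      TensorProduct.neg_tmul, TensorProduct.zero_tmul, ← TensorProduct.smul_tmul',
      TensorProduct.tmul_smul, Fin.zero_eta, Fin.mk_one, Fin.reduceFinMk]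
    match_scalars <;> grind

/-- The relation y⁴ = 0 is not assumed: only the quadratic relations are needed for y⁴ to be
primitive. For instance, y³ ⊗ y has coefficient 1 + q + q² + q³ = 0 with q = -ξ. -/
theorem comulMulY_yyy : comulMulY ξ T x y (comulTable ξ x y 3) =
    (y * (y * (y * y))) ⊗ₜ 1 + 1 ⊗ₜ (y * (y * (y * y))) := by
  simp only [comulTable, Matrix.cons_val, map_add, map_sub, map_smul, comulMulY_tmul, hT.act_one,
      hT.act_x, hT.act_y, hT.act_yx h, hT.act_yy hξ h, hT.act_yyx hξ h,
      hT.act_yyy hξ h, hT.act_yyyx hξ h, pick, mul_one,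
      h.xx, h.xy, h.xy_mul, mul_smul_comm, mul_zero, smul_zero, TensorProduct.tmul_zero,
      TensorProduct.neg_tmul, TensorProduct.zero_tmul, ← TensorProduct.smul_tmul',
      TensorProduct.tmul_smul]
  match_scalars <;> grind

theorem comulMulY_yyyx (hy : y * (y * (y * y)) = 0) :
    comulMulY ξ T x y (comulTable ξ x y 7) = 0 := by
  have hy' : y * (y * (y * (y * x))) = 0 := by
    rw [← mul_assoc y y x, ← mul_assoc y _ x, ← mul_assoc y _ x, hy, zero_mul]
  simp only [comulTable, Matrix.cons_val, map_add, map_sub, map_smul, comulMulY_tmul, hT.act_one,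
      hT.act_x, hT.act_y, hT.act_yx h, hT.act_yy hξ h, hT.act_yyx hξ h,
      hT.act_yyy hξ h, hT.act_yyyx hξ h, pick, mul_one,
      h.xx, h.xy, h.xy_mul, mul_smul_comm, mul_zero, smul_zero, TensorProduct.tmul_zero,
      TensorProduct.neg_tmul, TensorProduct.zero_tmul, ← TensorProduct.smul_tmul',
      TensorProduct.tmul_smul, hy, hy']
  match_scalars <;> grind

include h2

/-- Indices 3 and 7 are left out because there y times the word is y⁴ or y⁴x, which is not the next
word of the list. -/
theorem comulMulY_table (i : Fin 8) (hi : i ≠ 3) (hi' : i ≠ 7) :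
    comulMulY ξ T x y (comulTable ξ x y i) = comulTable ξ x y (i + 1) := by
  fin_cases i
  all_goals first
    | exact absurd rfl hi
    | exact absurd rfl hi'
    | simp only [comulTable, Matrix.cons_val, map_add, map_sub, map_smul, comulMulY_tmul,
        hT.act_one, hT.act_x, hT.act_y, hT.act_yx h, hT.act_yy hξ h, hT.act_yyx hξ h, pick,
        mul_one, h.xx, h.xy, h.xy_mul, mul_smul_comm, mul_zero, smul_zero,
        TensorProduct.tmul_zero, TensorProduct.neg_tmul, TensorProduct.zero_tmul,
        ← TensorProduct.smul_tmul', TensorProduct.tmul_smul, Fin.zero_eta, Fin.mk_one,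
        Fin.reduceFinMk, Fin.reduceAdd]
      match_scalars <;> grind

end IsWordAct

end HopfK

/-! ### The presented algebra has dimension eight -/

namespace PlaneAlg

open HopfK (IsPlanePair)

variable {k : Type u} [Field k] {ξ : k}

theorem isPlanePair (ξ : k) : IsPlanePair ξ (planeGen ξ 0) (planeGen ξ 1) where
  xx := by
    have := RingQuot.mkAlgHom_rel k (PlaneRel.xx (ξ := ξ))
    rwa [map_pow, map_zero, pow_two] at this
  xy := by
    have := RingQuot.mkAlgHom_rel k (PlaneRel.xy (ξ := ξ))
    rw [map_sub, map_smul, map_mul, map_mul, map_zero] at this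
    exact sub_eq_zero.mp this

theorem yyyy (ξ : k) :
    planeGen ξ 1 * (planeGen ξ 1 * (planeGen ξ 1 * planeGen ξ 1)) = 0 := by
  have := RingQuot.mkAlgHom_rel k (PlaneRel.yyyy (ξ := ξ))
  rw [map_pow, map_zero] at this
  rw [← this]
  simp only [pow_succ, pow_zero, one_mul, mul_assoc]
  rfl

section Lift

variable {B : Type*} [Ring B] [Algebra k B]

/-- The universal property of the presented algebra. -/
def lift {x y : B} (h : IsPlanePair ξ x y) (hy : y * (y * (y * y)) = 0) : PlaneAlg ξ →ₐ[k] B :=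
  RingQuot.liftAlgHom k ⟨FreeAlgebra.lift k ![x, y], by
    intro u v r
    cases r
    · simp [pow_two, h.xx]
    · simp [h.xy]
    · simp [pow_succ, mul_assoc, hy]⟩

theorem lift_gen {x y : B} (h : IsPlanePair ξ x y) (hy : y * (y * (y * y)) = 0) (i : Fin 2) :
    lift h hy (planeGen ξ i) = ![x, y] i := by
  unfold lift planeGen
  erw [RingQuot.liftAlgHom_mkAlgHom_apply]
  simp

end Lift

theorem adjoin_eq_top : Algebra.adjoin k {planeGen ξ 0, planeGen ξ 1} = ⊤ := by
  refine top_unique fun r _ => ?_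
  obtain ⟨s, rfl⟩ := RingQuot.mkAlgHom_surjective k (PlaneRel ξ) r
  induction s using FreeAlgebra.induction with
  | grade0 r => rw [AlgHom.commutes]; exact Subalgebra.algebraMap_mem _ r
  | grade1 i =>
    refine Algebra.subset_adjoin ?_
    fin_cases i
    exacts [Or.inl rfl, Or.inr rfl]
  | mul x y hx hy => rw [map_mul]; exact mul_mem (hx trivial) (hy trivial)
  | add x y hx hy => rw [map_add]; exact add_mem (hx trivial) (hy trivial)

/-- Induction over sums and products of the generators. -/
theorem mul_induction {P : PlaneAlg ξ → Prop} (algebraMap : ∀ r : k, P (algebraMap k _ r))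
    (x : P (planeGen ξ 0)) (y : P (planeGen ξ 1)) (mul : ∀ r s, P r → P s → P (r * s))
    (add : ∀ r s, P r → P s → P (r + s)) (r : PlaneAlg ξ) : P r := by
  have hr : r ∈ Algebra.adjoin k {planeGen ξ 0, planeGen ξ 1} :=
    adjoin_eq_top (ξ := ξ) ▸ Algebra.mem_top
  induction hr using Algebra.adjoin_induction with
  | mem r hr => rcases hr with rfl | rfl; exacts [x, y]
  | algebraMap r => exact algebraMap r
  | add r s _ _ hr hs => exact add r s hr hs
  | mul r s _ _ hr hs => exact mul r s hr hs

/-- The words `1, y, y², y³, x, yx, y²x, y³x`. -/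
def word {R : Type*} [Ring R] (x y : R) : Fin 8 → R :=
  ![1, y, y * y, y * (y * y), x, y * x, y * (y * x), y * (y * (y * x))]

/-- The operator `x` of the regular representation. -/
def regX (ξ : k) : Module.End k (Fin 8 → k) where
  toFun v := ![0, 0, 0, 0, v 0, ξ * v 1, ξ ^ 2 * v 2, ξ ^ 3 * v 3]
  map_add' v w := by ext i; fin_cases i <;> simp [mul_add]
  map_smul' c v := by ext i; fin_cases i <;> simp [mul_left_comm]

/-- The operator `y` of the regular representation. -/
def regY : Module.End k (Fin 8 → k) where
  toFun v := ![0, v 0, v 1, v 2, 0, v 4, v 5, v 6]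
  map_add' v w := by ext i; fin_cases i <;> simp
  map_smul' c v := by ext i; fin_cases i <;> simp

theorem regX_apply (ξ : k) (v : Fin 8 → k) :
    regX ξ v = ![0, 0, 0, 0, v 0, ξ * v 1, ξ ^ 2 * v 2, ξ ^ 3 * v 3] := rfl

theorem regY_apply (v : Fin 8 → k) : regY v = ![0, v 0, v 1, v 2, 0, v 4, v 5, v 6] := rfl

theorem isPlanePair_reg (ξ : k) : IsPlanePair ξ (regX ξ) regY where
  xx := by
    refine LinearMap.ext fun v => ?_
    ext i
    fin_cases i <;> simp [regX_apply]
  xy := by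
    refine LinearMap.ext fun v => ?_
    ext i
    fin_cases i <;> simp [regX_apply, regY_apply, pow_succ, mul_assoc]

theorem regY_yyyy : regY * (regY * (regY * regY)) = (0 : Module.End k (Fin 8 → k)) := by
  refine LinearMap.ext fun v => ?_
  ext i
  fin_cases i <;> simp [regY_apply]

/-- The coordinates with respect to the words, read off from the regular representation. -/
def regCoord (ξ : k) : PlaneAlg ξ →ₗ[k] (Fin 8 → k) :=
  (LinearMap.applyₗ (Pi.single 0 1)) ∘ₗ (lift (isPlanePair_reg ξ) regY_yyyy).toLinearMap

theorem regCoord_word (i : Fin 8) :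
    regCoord ξ (word (planeGen ξ 0) (planeGen ξ 1) i) = Pi.single i 1 := by
  ext j
  fin_cases i <;> fin_cases j <;> simp [regCoord, word, lift_gen, regX_apply, regY_apply]

/-- Applied to the first standard vector, the operators of the eight words give the eight standard
vectors of `Fin 8 → k`. -/
theorem linearIndependent_word :
    LinearIndependent k (word (planeGen ξ 0) (planeGen ξ 1)) := by
  refine LinearIndependent.of_comp (regCoord ξ) ?_
  have : regCoord ξ ∘ word (planeGen ξ 0) (planeGen ξ 1) = Pi.basisFun k (Fin 8) := by
    ext i
    rw [Function.comp_apply, regCoord_word, Pi.basisFun_apply]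
  rw [this]
  exact (Pi.basisFun k (Fin 8)).linearIndependent

/-- For i ≥ 4 the word already ends in x and the coefficient is zero, so the wrap-around of i + 4 in
`Fin 8` is harmless. -/
theorem x_mul_word (i : Fin 8) :
    planeGen ξ 0 * word (planeGen ξ 0) (planeGen ξ 1) i =
      ![1, ξ, ξ ^ 2, ξ ^ 3, 0, 0, 0, 0] i • word (planeGen ξ 0) (planeGen ξ 1) (i + 4) := by
  have h := isPlanePair ξ
  fin_cases i <;> simp [word, h.xx, h.xy, h.xy_mul, smul_smul, pow_succ, mul_assoc]

/-- At i = 3 and i = 7 the index i + 1 names an unrelated word; the zero coefficient there records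
y⁴ = 0 and y⁴x = 0. -/
theorem y_mul_word (i : Fin 8) :
    planeGen ξ 1 * word (planeGen ξ 0) (planeGen ξ 1) i =
      ![1, 1, 1, 0, 1, 1, 1, (0 : k)] i • word (planeGen ξ 0) (planeGen ξ 1) (i + 1) := by
  have h := isPlanePair ξ
  have hy := yyyy ξ
  have hy' : planeGen ξ 1 * (planeGen ξ 1 * (planeGen ξ 1 * (planeGen ξ 1 * planeGen ξ 0))) = 0 := by
    rw [← mul_assoc _ _ (planeGen ξ 0), ← mul_assoc _ _ (planeGen ξ 0),
      ← mul_assoc _ _ (planeGen ξ 0), hy, zero_mul]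
  fin_cases i <;> simp [word, hy, hy']

/-- The span of the words contains 1 and is stable under left multiplication by x and y, hence by
everything. -/
theorem span_word : Submodule.span k (Set.range (word (planeGen ξ 0) (planeGen ξ 1))) = ⊤ := by
  set S := Submodule.span k (Set.range (word (planeGen ξ 0) (planeGen ξ 1))) with hS
  have hw : ∀ i, word (planeGen ξ 0) (planeGen ξ 1) i ∈ S := fun i =>
    Submodule.subset_span ⟨i, rfl⟩
  have hmul : ∀ z : PlaneAlg ξ, (∀ i, z * word (planeGen ξ 0) (planeGen ξ 1) i ∈ S) →
      ∀ s ∈ S, z * s ∈ S := by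
    intro z hz s hs
    induction hs using Submodule.span_induction with
    | mem s hs => obtain ⟨i, rfl⟩ := hs; exact hz i
    | zero => rw [mul_zero]; exact S.zero_mem
    | add s t _ _ hs ht => rw [mul_add]; exact S.add_mem hs ht
    | smul c s _ hs => rw [mul_smul_comm]; exact S.smul_mem c hs
  have key : ∀ r : PlaneAlg ξ, ∀ s ∈ S, r * s ∈ S := by
    intro r
    induction r using mul_induction with
    | algebraMap r => intro s hs; rw [← Algebra.smul_def]; exact S.smul_mem r hs
    | x => exact hmul _ fun i => by rw [x_mul_word]; exact S.smul_mem _ (hw _)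
    | y => exact hmul _ fun i => by rw [y_mul_word]; exact S.smul_mem _ (hw _)
    | mul r s hr hs => intro t ht; rw [mul_assoc]; exact hr _ (hs _ ht)
    | add r s hr hs => intro t ht; rw [add_mul]; exact S.add_mem (hr _ ht) (hs _ ht)
  refine top_unique fun r _ => ?_
  have := key r 1 (hw 0)
  rwa [mul_one] at this

/-- The basis `1, y, y², y³, x, yx, y²x, y³x`. -/
def basis (ξ : k) : Module.Basis (Fin 8) k (PlaneAlg ξ) :=
  Module.Basis.mk linearIndependent_word span_word.ge

theorem basis_apply (i : Fin 8) : basis ξ i = word (planeGen ξ 0) (planeGen ξ 1) i := by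
  rw [basis, Module.Basis.mk_apply]

theorem finrank_eq (ξ : k) : Module.finrank k (PlaneAlg ξ) = 8 := by
  rw [Module.finrank_eq_card_basis (basis ξ), Fintype.card_fin]

/-- Linear maps that agree on the words are equal. -/
theorem linearMap_ext {M : Type*} [AddCommGroup M] [Module k M] {f g : PlaneAlg ξ →ₗ[k] M}
    (h : ∀ i, f (word (planeGen ξ 0) (planeGen ξ 1) i) =
      g (word (planeGen ξ 0) (planeGen ξ 1) i)) : f = g :=
  (basis ξ).ext fun i => by rw [basis_apply]; exact h i

end PlaneAlg

/-! ### Further products and coproducts in 𝒦 -/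

namespace HopfK

variable {k : Type u} [Field k] {ξ : k} (hξ : IsPrimitiveRoot ξ 4)

/-- Left multiplication by the generators on `a², ab, ac`. -/
theorem mul_table_two :
    gen hξ .d * (gen hξ .a * gen hξ .a) = gen hξ .a ∧
    gen hξ .d * (gen hξ .a * gen hξ .b) = gen hξ .b ∧
    gen hξ .d * (gen hξ .a * gen hξ .c) = gen hξ .c ∧
    gen hξ .b * (gen hξ .a * gen hξ .c) = 0 ∧
    gen hξ .b * (gen hξ .a * gen hξ .b) = 0 ∧
    gen hξ .c * (gen hξ .a * gen hξ .c) = 0 ∧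
    gen hξ .c * (gen hξ .a * gen hξ .b) = 0 ∧
    gen hξ .b * (gen hξ .a * gen hξ .a) = -gen hξ .c ∧
    gen hξ .c * (gen hξ .a * gen hξ .a) = -gen hξ .b := by
  have h := isRep_gen hξ
  have hx := xi_mul_xi hξ
  obtain ⟨hba, hca, hdd, hdb, hdc, hbd, hcd, haac, haab, haaa⟩ := mul_table hξ
  refine ⟨?_, ?_, ?_, ?_, ?_, ?_, ?_, ?_, ?_⟩
  · rw [← mul_assoc, h.da, one_mul]
  · rw [← mul_assoc, h.da, one_mul]
  · rw [← mul_assoc, h.da, one_mul]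
  · rw [← mul_assoc, hba, smul_mul_assoc, mul_assoc, h.bc, mul_zero, smul_zero]
  · rw [← mul_assoc, hba, smul_mul_assoc, mul_assoc, h.bb, mul_zero, smul_zero]
  · rw [← mul_assoc, hca, smul_mul_assoc, mul_assoc, h.cc, mul_zero, smul_zero]
  · rw [← mul_assoc, hca, smul_mul_assoc, mul_assoc, h.cb, mul_zero, smul_zero]
  · rw [← mul_assoc, hba, smul_mul_assoc, mul_assoc, hba, mul_smul_comm, haab, smul_smul,
      neg_mul_neg, hx, neg_one_smul]
  · rw [← mul_assoc, hca, smul_mul_assoc, mul_assoc, hca, mul_smul_comm, haac, smul_smul,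
      neg_mul_neg, hx, neg_one_smul]

/-- The cross terms cancel: ba ⊗ ca = ξ² (ab ⊗ ac) = -(ab ⊗ ac). This coproduct and the next are
needed because a² and ac occur in the coaction on words. -/
theorem comul_aa : Coalgebra.comul (R := k) (gen hξ .a * gen hξ .a) =
    (gen hξ .a * gen hξ .a) ⊗ₜ (gen hξ .a * gen hξ .a) := by
  have h := isRep_gen hξ
  have hx := xi_mul_xi hξ
  obtain ⟨hba, hca, -⟩ := mul_table hξ
  rw [Bialgebra.comul_mul, comul_gen, pick]
  simp only [mul_add, add_mul, Algebra.TensorProduct.tmul_mul_tmul, hba, hca, h.bb, h.cc,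
      TensorProduct.zero_tmul, TensorProduct.tmul_smul, ← TensorProduct.smul_tmul', smul_smul]
  match_scalars <;> grind

theorem comul_ac : Coalgebra.comul (R := k) (gen hξ .a * gen hξ .c) =
    (gen hξ .a * gen hξ .c) ⊗ₜ (gen hξ .a * gen hξ .a) + 1 ⊗ₜ (gen hξ .a * gen hξ .c) := by
  have h := isRep_gen hξ
  rw [Bialgebra.comul_mul, comul_gen, comul_gen, pick, pick]
  simp only [mul_add, add_mul, Algebra.TensorProduct.tmul_mul_tmul, h.bc, h.cc, h.ad,
      TensorProduct.zero_tmul, TensorProduct.tmul_zero, add_zero]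

end HopfK

namespace PlaneAlg

open HopfK

variable {k : Type u} [Field k] {ξ : k} {R : Type w} [Ring R] [Algebra k R]
  (e : PlaneAlg ξ ≃ₐ[k] R)

local notation "𝐱" => e (planeGen ξ 0)
local notation "𝐲" => e (planeGen ξ 1)

/-! ### Transport to an isomorphic algebra -/

section Transport

include e

/-- The structure is built on any algebra R with an isomorphism e from the presented one, so that
the arguments rest on the words and their relations only. The main theorem takes e to be the
identity. -/
theorem map_isPlanePair : IsPlanePair ξ 𝐱 𝐲 where
  xx := by rw [← map_mul, (isPlanePair ξ).xx, map_zero]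
  xy := by rw [← map_mul, (isPlanePair ξ).xy, map_smul, map_mul]

theorem map_yyyy : 𝐲 * (𝐲 * (𝐲 * 𝐲)) = 0 := by
  rw [← map_mul, ← map_mul, ← map_mul, yyyy, map_zero]

theorem map_yyyyx : 𝐲 * (𝐲 * (𝐲 * (𝐲 * 𝐱))) = 0 := by
  rw [← mul_assoc 𝐲 𝐲 𝐱, ← mul_assoc 𝐲 _ 𝐱, ← mul_assoc 𝐲 _ 𝐱, map_yyyy, zero_mul]

theorem map_word (i : Fin 8) : e (word (planeGen ξ 0) (planeGen ξ 1) i) = word 𝐱 𝐲 i := by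
  fin_cases i <;> simp [word]

theorem map_x_mul_word (i : Fin 8) :
    𝐱 * word 𝐱 𝐲 i = ![1, ξ, ξ ^ 2, ξ ^ 3, 0, 0, 0, 0] i • word 𝐱 𝐲 (i + 4) := by
  rw [← map_word, ← map_word, ← map_mul, x_mul_word, map_smul]

theorem map_y_mul_word (i : Fin 8) :
    𝐲 * word 𝐱 𝐲 i = ![1, 1, 1, 0, 1, 1, 1, (0 : k)] i • word 𝐱 𝐲 (i + 1) := by
  rw [← map_word, ← map_word, ← map_mul, y_mul_word, map_smul]

theorem map_mul_induction {P : R → Prop} (algebraMap : ∀ r : k, P (algebraMap k _ r))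
    (x : P 𝐱) (y : P 𝐲) (mul : ∀ r s, P r → P s → P (r * s))
    (add : ∀ r s, P r → P s → P (r + s)) (r : R) : P r := by
  obtain ⟨r, rfl⟩ := e.surjective r
  induction r using mul_induction with
  | algebraMap r => rw [AlgEquiv.commutes]; exact algebraMap r
  | x => exact x
  | y => exact y
  | mul r s hr hs => rw [map_mul]; exact mul _ _ hr hs
  | add r s hr hs => rw [map_add]; exact add _ _ hr hs

/-- The basis `1, y, y², y³, x, yx, y²x, y³x`. -/
def mapBasis : Module.Basis (Fin 8) k R := (basis ξ).map e.toLinearEquiv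

theorem mapBasis_apply (i : Fin 8) : mapBasis e i = word 𝐱 𝐲 i := by
  rw [← map_word, ← basis_apply]
  rfl

/-- Linear maps that agree on the words are equal. -/
theorem map_linearMap_ext {M : Type*} [AddCommGroup M] [Module k M] {f g : R →ₗ[k] M}
    (h : ∀ i, f (word 𝐱 𝐲 i) = g (word 𝐱 𝐲 i)) : f = g :=
  (mapBasis e).ext fun i => by rw [mapBasis_apply]; exact h i

end Transport

variable (hξ : IsPrimitiveRoot ξ 4)

/-! ### The action -/

section Act

-- The two matrices are (a·r, b·r; c·r, d·r) for r = x and r = y, as prescribed by V₂,₃. Since they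
-- satisfy the relations of the presented algebra, they extend to an algebra map, whose entries are
-- the operators a, b, c, d.
include hξ in
theorem isPlanePair_matrix : IsPlanePair ξ (!![-𝐱, 0; 0, -𝐱] : Matrix (Fin 2) (Fin 2) (R))
    !![ξ • 𝐲, 𝐱; 𝐱, -(ξ • 𝐲)] where
  xx := by
    have h := map_isPlanePair e
    ext i j
    fin_cases i <;> fin_cases j <;> simp [h.xx]
  xy := by
    have h := map_isPlanePair e
    have hx := xi_mul_xi hξ
    ext i j
    fin_cases i <;> fin_cases j <;> simp [h.xx, h.xy, smul_smul, hx]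

include hξ in
theorem yyyy_matrix : (!![ξ • 𝐲, 𝐱; 𝐱, -(ξ • 𝐲)] : Matrix (Fin 2) (Fin 2) (R)) *
    (!![ξ • 𝐲, 𝐱; 𝐱, -(ξ • 𝐲)] * (!![ξ • 𝐲, 𝐱; 𝐱, -(ξ • 𝐲)] * !![ξ • 𝐲, 𝐱; 𝐱, -(ξ • 𝐲)])) = 0 := by
  have h := map_isPlanePair e
  have hx := xi_mul_xi hξ
  have hy := map_yyyy e
  ext i j
  fin_cases i <;> fin_cases j <;>
    simp [h.xx, h.xy, h.xy_mul, mul_add, smul_smul, hx, hy]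

/-- The matrix of operators `a, b, c, d`. -/
def actMatrix : R →ₐ[k] Matrix (Fin 2) (Fin 2) (R) :=
  (lift (isPlanePair_matrix e hξ) (yyyy_matrix e hξ)).comp e.symm.toAlgHom

/-- The operators by which the generators of `𝒦` act on the presented algebra. -/
def actGen (i : KGen) : Module.End k (R) :=
  -- The operators a, b, c, d occupy the entries (0,0), (0,1), (1,0), (1,1).
  (Matrix.entryLinearMap k (R) (pick 0 0 1 1 i : Fin 2) (pick 0 1 0 1 i : Fin 2)) ∘ₗ
    (actMatrix e hξ).toLinearMap

theorem actGen_apply (i : KGen) (r : R) :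
    actGen e hξ i r = actMatrix e hξ r (pick 0 0 1 1 i) (pick 0 1 0 1 i) := rfl

/-- Matrix multiplication is the rule h·(rs) = (h₍₁₎·r)(h₍₂₎·s) for the matrix coproduct. -/
theorem actGen_mul (i : KGen) (r s : R) : actGen e hξ i (r * s) =
    pick (actGen e hξ .a r * actGen e hξ .a s + actGen e hξ .b r * actGen e hξ .c s)
      (actGen e hξ .a r * actGen e hξ .b s + actGen e hξ .b r * actGen e hξ .d s)
      (actGen e hξ .c r * actGen e hξ .a s + actGen e hξ .d r * actGen e hξ .c s)
      (actGen e hξ .c r * actGen e hξ .b s + actGen e hξ .d r * actGen e hξ .d s) i := by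
  simp only [actGen_apply, map_mul, Matrix.mul_apply, Fin.sum_univ_two]
  cases i <;> rfl

theorem isWordAct_actGen : IsWordAct ξ (actGen e hξ) 𝐱 𝐲 where
  act_one i := by cases i <;> simp [actGen_apply, pick]
  act_x i := by cases i <;> simp [actGen_apply, pick, actMatrix, lift_gen]
  act_y_mul i s := by
    rw [actGen_mul]
    cases i <;> simp [actGen_apply, pick, actMatrix, lift_gen, sub_eq_add_neg]

theorem isRep_actGen : IsRep ξ (actGen e hξ .a) (actGen e hξ .b) (actGen e hξ .c) (actGen e hξ .d) := by
  have h := map_isPlanePair e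
  have hx := xi_mul_xi hξ
  have hT := isWordAct_actGen e hξ
  constructor
  all_goals
    refine map_linearMap_ext e fun i => ?_
    fin_cases i
  all_goals
    simp only [word, Matrix.cons_val, Fin.zero_eta, Fin.mk_one, Fin.reduceFinMk,
      Module.End.mul_apply, Module.End.one_apply, LinearMap.zero_apply, LinearMap.smul_apply,
      hT.act_one, hT.act_x, hT.act_y, hT.act_yx h, hT.act_yy hx h, hT.act_yyx hx h,
      hT.act_yyy hx h, hT.act_yyyx hx h, pick, map_smul, map_neg, map_zero, smul_zero, neg_zero]
  all_goals match_scalars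
  all_goals grind

/-- The action of `𝒦` on the presented algebra. -/
def act : HopfK hξ →ₐ[k] Module.End k (R) := HopfK.lift hξ (isRep_actGen e hξ)

theorem act_gen (i : KGen) : act e hξ (gen hξ i) = actGen e hξ i := by
  rw [act, HopfK.lift_gen]
  cases i <;> rfl

end Act

/-! ### The coaction -/

section Coact

/-- The coaction on `x`. -/
def coactX : HopfK hξ ⊗[k] R := gen hξ .a ⊗ₜ 𝐱 - (1 + ξ) • (gen hξ .b ⊗ₜ 𝐲)

/-- The coaction on `y`. -/
def coactY : HopfK hξ ⊗[k] R := gen hξ .d ⊗ₜ 𝐲 + ((ξ - 1) / 2) • (gen hξ .c ⊗ₜ 𝐱)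

/-- The values of the coaction on the words. -/
def coactTable : Fin 8 → HopfK hξ ⊗[k] R :=
  ![1 ⊗ₜ 1,
    gen hξ .d ⊗ₜ 𝐲 + ((ξ - 1) / 2) • (gen hξ .c ⊗ₜ 𝐱),
    (gen hξ .a * gen hξ .a) ⊗ₜ (𝐲 * 𝐲),
    gen hξ .a ⊗ₜ (𝐲 * (𝐲 * 𝐲)) + ((ξ - 1) / 2) • (gen hξ .b ⊗ₜ (𝐲 * (𝐲 * 𝐱))),
    gen hξ .a ⊗ₜ 𝐱 - (1 + ξ) • (gen hξ .b ⊗ₜ 𝐲),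
    1 ⊗ₜ (𝐲 * 𝐱) - (1 + ξ) • ((gen hξ .a * gen hξ .c) ⊗ₜ (𝐲 * 𝐲)),
    gen hξ .d ⊗ₜ (𝐲 * (𝐲 * 𝐱)) - (1 + ξ) • (gen hξ .c ⊗ₜ (𝐲 * (𝐲 * 𝐲))),
    (gen hξ .a * gen hξ .a) ⊗ₜ (𝐲 * (𝐲 * (𝐲 * 𝐱)))]

/-- The structure constants agree with those of `x_mul_word` and, in the next lemma, `y_mul_word`.
This yields both the relations needed to define the coaction and its values on all words. -/
theorem coactX_mul_table (i : Fin 8) : coactX e hξ * coactTable e hξ i =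
    ![1, ξ, ξ ^ 2, ξ ^ 3, 0, 0, 0, 0] i • coactTable e hξ (i + 4) := by
  have h := isRep_gen hξ
  have hp := map_isPlanePair e
  have hy := map_yyyy e
  have hy' := map_yyyyx e
  have hx := xi_mul_xi hξ
  obtain ⟨hba, hca, hdd, hdb, hdc, hbd, hcd, haac, haab, haaa⟩ := mul_table hξ
  obtain ⟨hdaa, hdab, hdac, hbac, hbab, hcac, hcab, hbaa, hcaa⟩ := mul_table_two hξ
  fin_cases i
  all_goals
    simp only [coactX, coactTable, Matrix.cons_val, Fin.zero_eta, Fin.mk_one, Fin.reduceFinMk,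
      Fin.reduceAdd, mul_add, add_mul, mul_sub, sub_mul, Algebra.TensorProduct.tmul_mul_tmul,
      mul_smul_comm, smul_mul_assoc, hp.xx, hp.xy, hp.xy_mul, mul_one, mul_zero, hy, hy',
      h.da, h.ad, h.bc, h.cb, h.bb, h.cc, hba, hca, hdd, hdb, hdc, hbd, hcd, haac, haab, haaa,
      hbac, hbab, hcab, hcac, hbaa, hcaa, hdac, hdab, hdaa, TensorProduct.tmul_smul,
      ← TensorProduct.smul_tmul', TensorProduct.neg_tmul, TensorProduct.tmul_zero,
      TensorProduct.zero_tmul]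
    match_scalars
    all_goals grind

theorem coactY_mul_table (i : Fin 8) : coactY e hξ * coactTable e hξ i =
    ![1, 1, 1, 0, 1, 1, 1, (0 : k)] i • coactTable e hξ (i + 1) := by
  have h := isRep_gen hξ
  have hp := map_isPlanePair e
  have hy := map_yyyy e
  have hy' := map_yyyyx e
  have hx := xi_mul_xi hξ
  obtain ⟨hba, hca, hdd, hdb, hdc, hbd, hcd, haac, haab, haaa⟩ := mul_table hξ
  obtain ⟨hdaa, hdab, hdac, hbac, hbab, hcac, hcab, hbaa, hcaa⟩ := mul_table_two hξ
  fin_cases i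
  all_goals
    simp only [coactY, coactTable, Matrix.cons_val, Fin.zero_eta, Fin.mk_one, Fin.reduceFinMk,
      Fin.reduceAdd, mul_add, add_mul, mul_sub, sub_mul, Algebra.TensorProduct.tmul_mul_tmul,
      mul_smul_comm, smul_mul_assoc, hp.xx, hp.xy, hp.xy_mul, mul_one, mul_zero, hy, hy',
      h.da, h.ad, h.bc, h.cb, h.bb, h.cc, hba, hca, hdd, hdb, hdc, hbd, hcd, haac, haab, haaa,
      hbac, hbab, hcab, hcac, hbaa, hcaa, hdac, hdab, hdaa, TensorProduct.tmul_smul,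
      ← TensorProduct.smul_tmul', TensorProduct.neg_tmul, TensorProduct.tmul_zero,
      TensorProduct.zero_tmul]
    match_scalars
    all_goals grind

theorem isPlanePair_coact : IsPlanePair ξ (coactX e hξ) (coactY e hξ) where
  -- Entries 4 and 1 of the table are δ(x) and δ(y). So the products are read off there: δ(x)δ(x) =
  -- 0, and both δ(x)δ(y) and ξ δ(y)δ(x) are ξ times entry 5.
  xx := (coactX_mul_table e hξ 4).trans (zero_smul k _)
  xy := (coactX_mul_table e hξ 1).trans
    (congrArg _ ((coactY_mul_table e hξ 4).trans (one_smul k _)).symm)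

theorem yyyy_coact :
    coactY e hξ * (coactY e hξ * (coactY e hξ * coactY e hξ)) = 0 := by
  have h1 : coactY e hξ * coactY e hξ = coactTable e hξ 2 :=
    (coactY_mul_table e hξ 1).trans (one_smul k _)
  have h2 : coactY e hξ * coactTable e hξ 2 = coactTable e hξ 3 :=
    (coactY_mul_table e hξ 2).trans (one_smul k _)
  rw [h1, h2]
  exact (coactY_mul_table e hξ 3).trans (zero_smul k _)

/-- The coaction of `𝒦` on the presented algebra. -/
def coact : R →ₐ[k] HopfK hξ ⊗[k] R :=
  (lift (isPlanePair_coact e hξ) (yyyy_coact e hξ)).comp e.symm.toAlgHom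

theorem coact_x : coact e hξ 𝐱 = coactX e hξ := by simp [coact, lift_gen]

theorem coact_y : coact e hξ 𝐲 = coactY e hξ := by simp [coact, lift_gen]

theorem coact_word (i : Fin 8) : coact e hξ (word 𝐱 𝐲 i) = coactTable e hξ i := by
  have h0 : coact e hξ (word 𝐱 𝐲 0) = coactTable e hξ 0 := map_one _
  have h4 : coact e hξ (word 𝐱 𝐲 4) = coactTable e hξ 4 := coact_x e hξ
  have step : ∀ i, coact e hξ (word 𝐱 𝐲 i) = coactTable e hξ i →
      ![1, 1, 1, 0, 1, 1, 1, (0 : k)] i = 1 →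
      coact e hξ (word 𝐱 𝐲 (i + 1)) = coactTable e hξ (i + 1) := by
    intro i hi hc
    have hw := coactY_mul_table e hξ i
    have hm := map_y_mul_word e i
    rw [hc, one_smul] at hw hm
    rw [← hm, map_mul, coact_y, hi, hw]
  have h1 := step 0 h0 rfl
  have h2 := step 1 h1 rfl
  have h5 := step 4 h4 rfl
  have h6 := step 5 h5 rfl
  fin_cases i
  exacts [h0, h1, h2, step 2 h2 rfl, h4, h5, h6, step 6 h6 rfl]

theorem coact_table :
    coact e hξ 1 = 1 ⊗ₜ 1 ∧
    coact e hξ 𝐲 = gen hξ .d ⊗ₜ 𝐲 + ((ξ - 1) / 2) • (gen hξ .c ⊗ₜ 𝐱) ∧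
    coact e hξ (𝐲 * 𝐲) = (gen hξ .a * gen hξ .a) ⊗ₜ (𝐲 * 𝐲) ∧
    coact e hξ (𝐲 * (𝐲 * 𝐲)) =
      gen hξ .a ⊗ₜ (𝐲 * (𝐲 * 𝐲)) + ((ξ - 1) / 2) • (gen hξ .b ⊗ₜ (𝐲 * (𝐲 * 𝐱))) ∧
    coact e hξ 𝐱 = gen hξ .a ⊗ₜ 𝐱 - (1 + ξ) • (gen hξ .b ⊗ₜ 𝐲) ∧
    coact e hξ (𝐲 * 𝐱) = 1 ⊗ₜ (𝐲 * 𝐱) - (1 + ξ) • ((gen hξ .a * gen hξ .c) ⊗ₜ (𝐲 * 𝐲)) ∧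
    coact e hξ (𝐲 * (𝐲 * 𝐱)) =
      gen hξ .d ⊗ₜ (𝐲 * (𝐲 * 𝐱)) - (1 + ξ) • (gen hξ .c ⊗ₜ (𝐲 * (𝐲 * 𝐲))) ∧
    coact e hξ (𝐲 * (𝐲 * (𝐲 * 𝐱))) = (gen hξ .a * gen hξ .a) ⊗ₜ (𝐲 * (𝐲 * (𝐲 * 𝐱))) :=
  have h := coact_word e hξ
  ⟨h 0, h 1, h 2, h 3, h 4, h 5, h 6, h 7⟩

end Coact

end PlaneAlg

namespace PlaneAlg

open HopfK

variable {k : Type u} [Field k] {ξ : k} {R : Type w} [Ring R] [Algebra k R]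
  (e : PlaneAlg ξ ≃ₐ[k] R) (hξ : IsPrimitiveRoot ξ 4)

local notation "𝐱" => e (planeGen ξ 0)
local notation "𝐲" => e (planeGen ξ 1)

/-! ### The Yetter-Drinfeld module algebra -/

/-- The Yetter-Drinfeld condition for h and h' implies it for hh' by `ydTwist_mul`, so it is enough
to verify it for the four generators on the eight words. -/
theorem compat_gen (i : KGen) (v : R) : coact e hξ (act e hξ (gen hξ i) v) =
    ydTwist k _ (act e hξ) (comulThree k _ (gen hξ i)) (coact e hξ v) := by
  suffices (coact e hξ).toLinearMap ∘ₗ act e hξ (gen hξ i) =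
      ydTwist k _ (act e hξ) (comulThree k _ (gen hξ i)) ∘ₗ (coact e hξ).toLinearMap from
    LinearMap.congr_fun this v
  have h := isRep_gen hξ
  have hx := xi_mul_xi hξ
  have h2 := two_ne_zero_of_root hξ
  have hT := isWordAct_actGen e hξ
  have hp := map_isPlanePair e
  obtain ⟨hba, hca, hdd, hdb, hdc, hbd, hcd, haac, haab, haaa⟩ := mul_table hξ
  obtain ⟨hdaa, hdab, hdac, hbac, hbab, hcac, hcab, hbaa, hcaa⟩ := mul_table_two hξ
  refine map_linearMap_ext e fun j => ?_
  fin_cases j <;> cases i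
  all_goals
    simp only [LinearMap.comp_apply, comulThree, AlgHom.comp_apply, Bialgebra.comulAlgHom_apply,
      comul_gen, AlgHom.toLinearMap_apply, word, Matrix.cons_val, Fin.zero_eta, Fin.mk_one,
      Fin.reduceFinMk, act_gen, hT.act_one, hT.act_x, hT.act_y, hT.act_yx hp, hT.act_yy hx hp,
      hT.act_yyx hx hp, hT.act_yyy hx hp, hT.act_yyyx hx hp, pick,
      coact_table e hξ, map_add, map_sub,
      map_smul, map_neg, map_zero, Algebra.TensorProduct.map_tmul, AlgHom.id_apply,
      TensorProduct.tmul_add, LinearMap.add_apply, ydTwist_tmul, antipode_gen]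
  all_goals
    simp only [TensorProduct.tmul_zero, TensorProduct.tmul_neg, TensorProduct.tmul_smul,
      mul_smul_comm, smul_mul_assoc, ← TensorProduct.smul_tmul', smul_smul, h.da, h.ad, h.bc,
      h.cb, h.bb, h.cc, hba,
      hca, hdd, hdb, hdc, hbd, hcd, haac, haab, haaa, mul_zero, TensorProduct.zero_tmul, smul_zero,
      add_zero, zero_add, mul_one, one_mul, hbac, hbab, hcab, hcac, hbaa, hcaa, hdac, hdab, hdaa,
      mul_assoc, mul_neg, neg_mul,
      TensorProduct.neg_tmul, neg_zero, neg_mul_neg, hx]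
  all_goals match_scalars
  all_goals
    clear h hT hp hba hca hdd hdb hdc hbd hcd haac haab haaa hdaa hdab hdac hbac hbab hcac hcab
      hbaa hcaa
    grind

/-- The Yetter-Drinfeld module structure on the presented algebra. -/
def ydModule : YDModule k (HopfK hξ) R where
  act := act e hξ
  coact := (coact e hξ).toLinearMap
  coassoc := by
    have hx := xi_mul_xi hξ
    have h2 := two_ne_zero_of_root hξ
    refine map_linearMap_ext e fun j => ?_
    fin_cases j
    all_goals
      simp only [LinearMap.comp_apply, AlgHom.toLinearMap_apply, word, Matrix.cons_val,
        Fin.zero_eta, Fin.mk_one, Fin.reduceFinMk, coact_table e hξ, map_add, map_sub, map_smul,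
        LinearMap.rTensor_tmul, LinearMap.lTensor_tmul, comul_gen, comul_aa, comul_ac,
        Bialgebra.comul_one, Algebra.TensorProduct.one_def, pick, TensorProduct.add_tmul,
        TensorProduct.tmul_add, TensorProduct.tmul_sub, TensorProduct.tmul_smul,
        LinearEquiv.coe_coe, TensorProduct.assoc_tmul]
    all_goals match_scalars
    all_goals grind
  counit_coact := by
    refine map_linearMap_ext e fun j => ?_
    fin_cases j
    all_goals simp [word, coact_table e hξ, counit_gen, pick]
  compat := by
    intro h
    induction h using HopfK.induction with
    | algebraMap r =>
      intro v
      have h1 : ∀ z, ydTwist k _ (act e hξ) (1 : HopfK hξ ⊗[k] (HopfK hξ ⊗[k] HopfK hξ)) z = z := by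
        intro z
        induction z with
        | zero => simp
        | add z w hz hw => rw [map_add, hz, hw]
        | tmul m v =>
          rw [Algebra.TensorProduct.one_def, Algebra.TensorProduct.one_def, ydTwist_tmul]
          simp
      rw [Algebra.algebraMap_eq_smul_one, map_smul, map_one, map_smul, map_one, map_smul,
        LinearMap.smul_apply, LinearMap.smul_apply, h1, map_smul, Module.End.one_apply]
    | gen i => exact compat_gen e hξ i
    | mul x y hX hY =>
      intro v
      rw [map_mul, map_mul, Module.End.mul_apply, hX, hY, ydTwist_mul]
    | add x y hX hY =>
      intro v
      simp only [map_add, LinearMap.add_apply, hX, hY]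

theorem ydModule_act_gen (i : KGen) : (ydModule e hξ).act (gen hξ i) = actGen e hξ i :=
  act_gen e hξ i

/-- Compatibility of the coaction with products holds by construction. For the action, `actGen_mul`
gives it on generators, and both sides are multiplicative in h. -/
theorem isAlgebra_ydModule : (ydModule e hξ).IsAlgebra where
  act_mul h := by
    refine LinearMap.congr_fun (f := (ydModule e hξ).act h ∘ₗ LinearMap.mul' k R)
      (g := LinearMap.mul' k R ∘ₗ (ydModule e hξ).tensorAct (ydModule e hξ) h) ?_
    induction h using HopfK.induction with
    | algebraMap r =>
      rw [AlgHom.commutes, AlgHom.commutes]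
      ext
      simp [Module.algebraMap_end_apply]
    | gen i =>
      ext r s
      simp only [TensorProduct.AlgebraTensorModule.curry_apply, LinearMap.restrictScalars_self,
        TensorProduct.curry_apply, LinearMap.comp_apply, LinearMap.mul'_apply,
        YDModule.tensorAct_tmul, comul_gen, ydModule_act_gen, actGen_mul]
      cases i <;> simp [pick, ydModule_act_gen]
    | mul x y hX hY =>
      rw [map_mul, map_mul, Module.End.mul_eq_comp, LinearMap.comp_assoc, hY,
        ← LinearMap.comp_assoc, hX]
      rfl
    | add x y hX hY => rw [map_add, map_add, LinearMap.add_comp, LinearMap.comp_add, hX, hY]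
  act_one h := by
    induction h using HopfK.induction with
    | algebraMap r => simp [Module.algebraMap_end_apply]
    | gen i =>
      rw [ydModule_act_gen, (isWordAct_actGen e hξ).act_one, counit_gen]
      cases i <;> simp [pick]
    | mul x y hX hY =>
      rw [map_mul, Module.End.mul_apply, hY, map_smul, hX, smul_smul, Bialgebra.counit_mul,
        mul_comm]
    | add x y hX hY => rw [map_add, LinearMap.add_apply, hX, hY, map_add, add_smul]
  coact_mul r s := map_mul (coact e hξ) r s
  coact_one := map_one (coact e hξ)

end PlaneAlg

/-! ### Braided multiplication by x ⊗ 1 + 1 ⊗ x and y ⊗ 1 + 1 ⊗ y -/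

namespace HopfK

section

variable {k : Type u} [Field k] {ξ : k} {hξ : IsPrimitiveRoot ξ 4} {R : Type w} [Ring R]
  [Algebra k R]

theorem braidedMul_one_left {X : YDModule k (HopfK hξ) R} (hX : X.IsAlgebra) (p : R)
    (z : R ⊗[k] R) :
    X.braidedMul ((p ⊗ₜ 1) ⊗ₜ z) = TensorProduct.map (LinearMap.mulLeft k p) LinearMap.id z := by
  induction z with
  | zero => simp
  | add z w hz hw => rw [TensorProduct.tmul_add, map_add, map_add, hz, hw]
  | tmul r s =>
    rw [YDModule.braidedMul_tmul, hX.coact_one, Algebra.TensorProduct.one_def,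
      YDModule.braidedMulAux_tmul]
    simp

/-- The braided product (1 ⊗ x)(r ⊗ s) involves only δ(x) and the action on r, so the formula holds
in every algebra of Yetter-Drinfeld modules with this δ(x). -/
theorem braidedMul_x {X : YDModule k (HopfK hξ) R} (hX : X.IsAlgebra) {x y : R}
    (hx : X.coact x = gen hξ .a ⊗ₜ x - (1 + ξ) • (gen hξ .b ⊗ₜ y)) (z : R ⊗[k] R) :
    X.braidedMul ((x ⊗ₜ 1 + 1 ⊗ₜ x) ⊗ₜ z) =
      comulMulX ξ (fun i => X.act (gen hξ i)) x y z := by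
  rw [TensorProduct.add_tmul, map_add, braidedMul_one_left hX]
  induction z with
  | zero => simp
  | add z w hz hw => rw [TensorProduct.tmul_add, map_add, map_add, map_add, ← hz, ← hw]; abel
  | tmul r s =>
    rw [YDModule.braidedMul_tmul, hx, map_sub, map_smul, YDModule.braidedMulAux_tmul,
      YDModule.braidedMulAux_tmul, comulMulX_tmul, one_mul, one_mul, add_sub_assoc]
    rfl

theorem braidedMul_y {X : YDModule k (HopfK hξ) R} (hX : X.IsAlgebra) {x y : R}
    (hy : X.coact y = gen hξ .d ⊗ₜ y + ((ξ - 1) / 2) • (gen hξ .c ⊗ₜ x)) (z : R ⊗[k] R) :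
    X.braidedMul ((y ⊗ₜ 1 + 1 ⊗ₜ y) ⊗ₜ z) =
      comulMulY ξ (fun i => X.act (gen hξ i)) x y z := by
  rw [TensorProduct.add_tmul, map_add, braidedMul_one_left hX]
  induction z with
  | zero => simp
  | add z w hz hw => rw [TensorProduct.tmul_add, map_add, map_add, map_add, ← hz, ← hw]; abel
  | tmul r s =>
    rw [YDModule.braidedMul_tmul, hy, map_add, map_smul, YDModule.braidedMulAux_tmul,
      YDModule.braidedMulAux_tmul, comulMulY_tmul, one_mul, one_mul, add_assoc]
    rfl

theorem tensorAct_gen (X : YDModule k (HopfK hξ) R) (i : KGen) (r s : R) :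
    X.tensorAct X (gen hξ i) (r ⊗ₜ s) =
      pick (X.act (gen hξ .a) r ⊗ₜ X.act (gen hξ .a) s + X.act (gen hξ .b) r ⊗ₜ X.act (gen hξ .c) s)
        (X.act (gen hξ .a) r ⊗ₜ X.act (gen hξ .b) s + X.act (gen hξ .b) r ⊗ₜ X.act (gen hξ .d) s)
        (X.act (gen hξ .c) r ⊗ₜ X.act (gen hξ .a) s + X.act (gen hξ .d) r ⊗ₜ X.act (gen hξ .c) s)
        (X.act (gen hξ .c) r ⊗ₜ X.act (gen hξ .b) s + X.act (gen hξ .d) r ⊗ₜ X.act (gen hξ .d) s)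
        i := by
  rw [YDModule.tensorAct_tmul, comul_gen]
  cases i <;> simp [pick]

end

end HopfK

namespace PlaneAlg

open HopfK

variable {k : Type u} [Field k] {ξ : k} {R : Type w} [Ring R] [Algebra k R]
  (e : PlaneAlg ξ ≃ₐ[k] R) (hξ : IsPrimitiveRoot ξ 4)

local notation "𝐱" => e (planeGen ξ 0)
local notation "𝐲" => e (planeGen ξ 1)

/-! ### The braided Hopf algebra -/

/-- The comultiplication of the presented algebra. -/
def comul : R →ₗ[k] R ⊗[k] R := (mapBasis e).constr k (comulTable ξ 𝐱 𝐲)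

theorem comul_word (i : Fin 8) : comul e (word 𝐱 𝐲 i) = comulTable ξ 𝐱 𝐲 i := by
  rw [← mapBasis_apply, comul, Module.Basis.constr_basis]

theorem comul_table :
    comul e 1 = 1 ⊗ₜ 1 ∧
    comul e 𝐲 = 𝐲 ⊗ₜ 1 + 1 ⊗ₜ 𝐲 ∧
    comul e (𝐲 * 𝐲) = (𝐲 * 𝐲) ⊗ₜ 1 + (1 - ξ) • (𝐲 ⊗ₜ 𝐲) + ((ξ - 1) / 2) • (𝐱 ⊗ₜ 𝐱) + 1 ⊗ₜ (𝐲 * 𝐲) ∧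
    comul e (𝐲 * (𝐲 * 𝐲)) =
      (𝐲 * (𝐲 * 𝐲)) ⊗ₜ 1 - ξ • ((𝐲 * 𝐲) ⊗ₜ 𝐲) + ((1 + ξ) / 2) • ((𝐲 * 𝐱) ⊗ₜ 𝐱)
      - ξ • (𝐲 ⊗ₜ (𝐲 * 𝐲)) - ((1 + ξ) / 2) • (𝐱 ⊗ₜ (𝐲 * 𝐱)) + 1 ⊗ₜ (𝐲 * (𝐲 * 𝐲)) ∧
    comul e 𝐱 = 𝐱 ⊗ₜ 1 + 1 ⊗ₜ 𝐱 ∧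
    comul e (𝐲 * 𝐱) = (𝐲 * 𝐱) ⊗ₜ 1 - 𝐱 ⊗ₜ 𝐲 + 𝐲 ⊗ₜ 𝐱 + 1 ⊗ₜ (𝐲 * 𝐱) ∧
    comul e (𝐲 * (𝐲 * 𝐱)) = (𝐲 * (𝐲 * 𝐱)) ⊗ₜ 1 + (ξ - 1) • ((𝐲 * 𝐱) ⊗ₜ 𝐲) + 𝐱 ⊗ₜ (𝐲 * 𝐲)
      + (𝐲 * 𝐲) ⊗ₜ 𝐱 + (1 - ξ) • (𝐲 ⊗ₜ (𝐲 * 𝐱)) + 1 ⊗ₜ (𝐲 * (𝐲 * 𝐱)) ∧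
    comul e (𝐲 * (𝐲 * (𝐲 * 𝐱))) = (𝐲 * (𝐲 * (𝐲 * 𝐱))) ⊗ₜ 1 + ξ • ((𝐲 * (𝐲 * 𝐱)) ⊗ₜ 𝐲)
      - ξ • ((𝐲 * 𝐱) ⊗ₜ (𝐲 * 𝐲)) - 𝐱 ⊗ₜ (𝐲 * (𝐲 * 𝐲)) + (𝐲 * (𝐲 * 𝐲)) ⊗ₜ 𝐱
      - ξ • ((𝐲 * 𝐲) ⊗ₜ (𝐲 * 𝐱)) - ξ • (𝐲 ⊗ₜ (𝐲 * (𝐲 * 𝐱))) + 1 ⊗ₜ (𝐲 * (𝐲 * (𝐲 * 𝐱))) :=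
  have h := comul_word e
  ⟨h 0, h 1, h 2, h 3, h 4, h 5, h 6, h 7⟩

include hξ in
theorem comul_x_mul (s : R) :
    comul e (𝐱 * s) = comulMulX ξ (actGen e hξ) 𝐱 𝐲 (comul e s) := by
  refine LinearMap.congr_fun (f := comul e ∘ₗ LinearMap.mulLeft k 𝐱)
    (g := comulMulX ξ (actGen e hξ) 𝐱 𝐲 ∘ₗ comul e) (map_linearMap_ext e fun i => ?_) s
  have hx := xi_mul_xi hξ
  rw [LinearMap.comp_apply, LinearMap.comp_apply, LinearMap.mulLeft_apply, map_x_mul_word,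
    map_smul, comul_word, comul_word,
    (isWordAct_actGen e hξ).comulMulX_table hx (map_isPlanePair e)]
  have h3 : ξ ^ 2 = -1 := by rw [pow_two, hx]
  have h4 : ξ ^ 3 = -ξ := by rw [pow_succ, h3, neg_one_mul]
  fin_cases i <;> simp [h3, h4]

theorem comul_y_mul (s : R) :
    comul e (𝐲 * s) = comulMulY ξ (actGen e hξ) 𝐱 𝐲 (comul e s) := by
  refine LinearMap.congr_fun (f := comul e ∘ₗ LinearMap.mulLeft k 𝐲)
    (g := comulMulY ξ (actGen e hξ) 𝐱 𝐲 ∘ₗ comul e) (map_linearMap_ext e fun i => ?_) s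
  have h2 := two_ne_zero_of_root hξ
  have hx := xi_mul_xi hξ
  have hT := isWordAct_actGen e hξ
  have hp := map_isPlanePair e
  rw [LinearMap.comp_apply, LinearMap.comp_apply, LinearMap.mulLeft_apply, map_y_mul_word,
    map_smul, comul_word, comul_word]
  by_cases h3 : i = 3
  · subst h3
    rw [hT.comulMulY_yyy hx hp, map_yyyy]
    simp
  by_cases h7 : i = 7
  · subst h7
    rw [hT.comulMulY_yyyx hx hp (map_yyyy e)]
    simp
  rw [hT.comulMulY_table hx h2 hp i h3 h7]
  fin_cases i <;> first | exact absurd rfl h3 | exact absurd rfl h7 | exact one_smul k _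

/-- Induction on the left factor, for all s at once: associativity of the braided product carries
the claim from r and r' to rr', which leaves the cases r = x and r = y. -/
theorem comul_mul (r s : R) :
    comul e (r * s) = (ydModule e hξ).braidedMul (comul e r ⊗ₜ comul e s) := by
  have hX := isAlgebra_ydModule e hξ
  have hT : (fun i => (ydModule e hξ).act (gen hξ i)) = actGen e hξ :=
    funext (ydModule_act_gen e hξ)
  induction r using map_mul_induction e generalizing s with
  | algebraMap r =>
    rw [Algebra.algebraMap_eq_smul_one, map_smul, (comul_table e).1, smul_mul_assoc, one_mul,
      map_smul, ← TensorProduct.smul_tmul', map_smul, braidedMul_one_left hX,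
      LinearMap.mulLeft_one, TensorProduct.map_id, LinearMap.id_apply]
  | x =>
    rw [(comul_table e).2.2.2.2.1, braidedMul_x hX (coact_x e hξ), hT, comul_x_mul e hξ]
  | y =>
    rw [(comul_table e).2.1, braidedMul_y hX (coact_y e hξ), hT, comul_y_mul e hξ]
  | mul r r' hr hr' => rw [mul_assoc, hr, hr', hr, hX.braidedMul_assoc]
  | add r r' hr hr' => rw [add_mul, map_add, hr, hr', map_add, TensorProduct.add_tmul, map_add]

/-- The counit of the presented algebra. -/
def counit : R →ₐ[k] k :=
  (lift (ξ := ξ) (x := (0 : k)) (y := 0) ⟨by simp, by simp⟩ (by simp)).comp e.symm.toAlgHom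

theorem counit_x : counit e 𝐱 = 0 := by simp [counit, lift_gen]

theorem counit_y : counit e 𝐲 = 0 := by simp [counit, lift_gen]

/-- The antipode of the presented algebra. -/
def antipode : R →ₗ[k] R := (mapBasis e).constr k
  -- The antipode reverses products through the braiding, so S(ys) = -m c(y ⊗ S(s)); these values
  -- follow by recursion from S(1) = 1 and S(x) = -x.
  ![1, -𝐲, -ξ • (𝐲 * 𝐲), -ξ • (𝐲 * (𝐲 * 𝐲)), -𝐱, -ξ • (𝐲 * 𝐱), -ξ • (𝐲 * (𝐲 * 𝐱)),
    -(𝐲 * (𝐲 * (𝐲 * 𝐱)))]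

theorem antipode_table :
    antipode e 1 = 1 ∧ antipode e 𝐲 = -𝐲 ∧ antipode e (𝐲 * 𝐲) = -ξ • (𝐲 * 𝐲) ∧
    antipode e (𝐲 * (𝐲 * 𝐲)) = -ξ • (𝐲 * (𝐲 * 𝐲)) ∧ antipode e 𝐱 = -𝐱 ∧
    antipode e (𝐲 * 𝐱) = -ξ • (𝐲 * 𝐱) ∧ antipode e (𝐲 * (𝐲 * 𝐱)) = -ξ • (𝐲 * (𝐲 * 𝐱)) ∧
    antipode e (𝐲 * (𝐲 * (𝐲 * 𝐱))) = -(𝐲 * (𝐲 * (𝐲 * 𝐱))) := by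
  have h := fun i => (mapBasis e).constr_basis k
    ![1, -𝐲, -ξ • (𝐲 * 𝐲), -ξ • (𝐲 * (𝐲 * 𝐲)), -𝐱, -ξ • (𝐲 * 𝐱), -ξ • (𝐲 * (𝐲 * 𝐱)),
      -(𝐲 * (𝐲 * (𝐲 * 𝐱)))] i
  simp only [mapBasis_apply] at h
  exact ⟨h 0, h 1, h 2, h 3, h 4, h 5, h 6, h 7⟩

include hξ in
theorem comul_coassoc : (TensorProduct.assoc k R R R).toLinearMap ∘ₗ (comul e).rTensor R ∘ₗ
    comul e = (comul e).lTensor R ∘ₗ comul e := by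
  have hx := xi_mul_xi hξ
  have h2 := two_ne_zero_of_root hξ
  refine map_linearMap_ext e fun j => ?_
  fin_cases j
  all_goals
    simp only [LinearMap.comp_apply, word, Matrix.cons_val,
      Fin.zero_eta, Fin.mk_one, Fin.reduceFinMk, comul_table e, map_add, map_sub, map_smul,
      LinearMap.rTensor_tmul, LinearMap.lTensor_tmul, TensorProduct.add_tmul,
      TensorProduct.sub_tmul, ← TensorProduct.smul_tmul',
      TensorProduct.tmul_add, TensorProduct.tmul_sub, TensorProduct.tmul_smul,
      LinearEquiv.coe_coe, TensorProduct.assoc_tmul]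
  all_goals match_scalars
  all_goals grind

theorem counit_left (r : R) :
    TensorProduct.lid k R ((counit e).toLinearMap.rTensor R (comul e r)) = r := by
  refine LinearMap.congr_fun (f := (TensorProduct.lid k R).toLinearMap ∘ₗ
    (counit e).toLinearMap.rTensor R ∘ₗ comul e) (g := LinearMap.id)
    (map_linearMap_ext e fun i => ?_) r
  fin_cases i <;> simp [word, comul_table e, counit_x, counit_y]

theorem counit_right (r : R) :
    TensorProduct.rid k R ((counit e).toLinearMap.lTensor R (comul e r)) = r := by
  refine LinearMap.congr_fun (f := (TensorProduct.rid k R).toLinearMap ∘ₗ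
    (counit e).toLinearMap.lTensor R ∘ₗ comul e) (g := LinearMap.id)
    (map_linearMap_ext e fun i => ?_) r
  fin_cases i <;> simp [word, comul_table e, counit_x, counit_y]

/-- Both actions are multiplicative in h, so generators and words decide. The same reduction is used
for the counit and the antipode. -/
theorem comul_act (h : HopfK hξ) (r : R) : comul e ((ydModule e hξ).act h r) =
    (ydModule e hξ).tensorAct (ydModule e hξ) h (comul e r) := by
  induction h using HopfK.induction generalizing r with
  | algebraMap c => simp [Module.algebraMap_end_apply]
  | mul x y hX hY =>
    rw [map_mul, map_mul, Module.End.mul_apply, Module.End.mul_apply, hX, hY]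
  | add x y hX hY => simp only [map_add, LinearMap.add_apply, hX, hY]
  | gen i =>
    refine LinearMap.congr_fun (f := comul e ∘ₗ (ydModule e hξ).act (gen hξ i))
      (g := (ydModule e hξ).tensorAct (ydModule e hξ) (gen hξ i) ∘ₗ comul e)
      (map_linearMap_ext e fun j => ?_) r
    have hx := xi_mul_xi hξ
    have hT := isWordAct_actGen e hξ
    have hp := map_isPlanePair e
    fin_cases j <;> cases i
    all_goals
      simp only [LinearMap.comp_apply, word, Matrix.cons_val,
        Fin.zero_eta, Fin.mk_one, Fin.reduceFinMk, ydModule_act_gen, comul_table e, map_add,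
        map_sub, map_smul, map_neg, map_zero, tensorAct_gen,
        hT.act_one, hT.act_x, hT.act_y, hT.act_yx hp, hT.act_yy hx hp,
        hT.act_yyx hx hp, hT.act_yyy hx hp, hT.act_yyyx hx hp, pick,
        ← TensorProduct.smul_tmul', TensorProduct.tmul_smul, TensorProduct.tmul_zero,
        TensorProduct.zero_tmul, TensorProduct.neg_tmul, TensorProduct.tmul_neg]
    all_goals match_scalars
    all_goals grind

end PlaneAlg

namespace PlaneAlg

open HopfK

variable {k : Type u} [Field k] {ξ : k} {R : Type w} [Ring R] [Algebra k R]
  (e : PlaneAlg ξ ≃ₐ[k] R) (hξ : IsPrimitiveRoot ξ 4)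

local notation "𝐱" => e (planeGen ξ 0)
local notation "𝐲" => e (planeGen ξ 1)

theorem tensorCoact_tmul (r s : R) :
    (ydModule e hξ).tensorCoact (ydModule e hξ) (r ⊗ₜ s) =
      (LinearMap.mul' k (HopfK hξ)).rTensor (R ⊗[k] R)
        (TensorProduct.tensorTensorTensorComm k (HopfK hξ) R (HopfK hξ) R
          (coact e hξ r ⊗ₜ coact e hξ s)) := rfl

theorem comul_coact (r : R) : (comul e).lTensor (HopfK hξ) (coact e hξ r) =
    (ydModule e hξ).tensorCoact (ydModule e hξ) (comul e r) := by
  refine LinearMap.congr_fun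
    (f := (comul e).lTensor (HopfK hξ) ∘ₗ (coact e hξ).toLinearMap)
    (g := (ydModule e hξ).tensorCoact (ydModule e hξ) ∘ₗ comul e)
    (map_linearMap_ext e fun j => ?_) r
  have h := isRep_gen hξ
  have hx := xi_mul_xi hξ
  have h2 := two_ne_zero_of_root hξ
  obtain ⟨hba, hca, hdd, hdb, hdc, hbd, hcd, haac, haab, haaa⟩ := mul_table hξ
  obtain ⟨hdaa, hdab, hdac, hbac, hbab, hcac, hcab, hbaa, hcaa⟩ := mul_table_two hξ
  fin_cases j
  all_goals
    simp only [LinearMap.comp_apply, AlgHom.toLinearMap_apply, word, Matrix.cons_val,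
      Fin.zero_eta, Fin.mk_one, Fin.reduceFinMk, comul_table e, coact_table e hξ, map_add, map_sub,
      map_smul, tensorCoact_tmul, LinearMap.lTensor_tmul, TensorProduct.add_tmul,
      TensorProduct.sub_tmul, ← TensorProduct.smul_tmul', TensorProduct.tmul_add,
      TensorProduct.tmul_sub, TensorProduct.tmul_smul,
      TensorProduct.tensorTensorTensorComm_tmul, LinearMap.rTensor_tmul, LinearMap.mul'_apply]
  all_goals
    simp only [mul_assoc, mul_smul_comm, mul_neg, mul_zero, h.da, h.ad, h.bc, h.cb, h.bb, h.cc, hba,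
      hca, hdd, hdb, hdc, hbd, hcd, haac, haab, haaa, mul_one, one_mul,
      hbac, hbab, hcab, hcac, hbaa, hcaa, hdac, hdab, hdaa, TensorProduct.neg_tmul,
      TensorProduct.zero_tmul, ← TensorProduct.smul_tmul']
  all_goals match_scalars
  all_goals
    clear h hba hca hdd hdb hdc hbd hcd haac haab haaa hdaa hdab hdac hbac hbab hcac hcab hbaa hcaa
    grind

theorem counit_act (h : HopfK hξ) (r : R) : counit e ((ydModule e hξ).act h r) =
    Coalgebra.counit (R := k) h * counit e r := by
  induction h using HopfK.induction generalizing r with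
  | algebraMap c => simp [Module.algebraMap_end_apply]
  | mul x y hX hY =>
    rw [map_mul, Module.End.mul_apply, hX, hY, Bialgebra.counit_mul, mul_assoc]
  | add x y hX hY => simp only [map_add, LinearMap.add_apply, hX, hY, add_mul]
  | gen i =>
    refine LinearMap.congr_fun
      (f := (counit e).toLinearMap ∘ₗ (ydModule e hξ).act (gen hξ i))
      (g := Coalgebra.counit (R := k) (gen hξ i) • (counit e).toLinearMap)
      (map_linearMap_ext e fun j => ?_) r
    have hx := xi_mul_xi hξ
    have hT := isWordAct_actGen e hξ
    have hp := map_isPlanePair e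
    fin_cases j <;> cases i <;>
      simp [word, ydModule_act_gen, counit_gen, hT.act_one, hT.act_x, hT.act_y, hT.act_yx hp,
        hT.act_yy hx hp, hT.act_yyx hx hp, hT.act_yyy hx hp, hT.act_yyyx hx hp, pick, counit_x,
        counit_y]

theorem counit_coact (r : R) : (counit e).toLinearMap.lTensor (HopfK hξ) (coact e hξ r) =
    (1 : HopfK hξ) ⊗ₜ[k] counit e r := by
  refine LinearMap.congr_fun
    (f := (counit e).toLinearMap.lTensor (HopfK hξ) ∘ₗ (coact e hξ).toLinearMap)
    (g := TensorProduct.mk k (HopfK hξ) k 1 ∘ₗ (counit e).toLinearMap)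
    (map_linearMap_ext e fun j => ?_) r
  fin_cases j <;> simp [word, coact_table e hξ, counit_x, counit_y]

theorem antipode_act (h : HopfK hξ) (r : R) : antipode e ((ydModule e hξ).act h r) =
    (ydModule e hξ).act h (antipode e r) := by
  induction h using HopfK.induction generalizing r with
  | algebraMap c => simp [Module.algebraMap_end_apply]
  | mul x y hX hY =>
    rw [map_mul, Module.End.mul_apply, Module.End.mul_apply, hX, hY]
  | add x y hX hY => simp only [map_add, LinearMap.add_apply, hX, hY]
  | gen i =>
    refine LinearMap.congr_fun
      (f := antipode e ∘ₗ (ydModule e hξ).act (gen hξ i))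
      (g := (ydModule e hξ).act (gen hξ i) ∘ₗ antipode e)
      (map_linearMap_ext e fun j => ?_) r
    have hx := xi_mul_xi hξ
    have hT := isWordAct_actGen e hξ
    have hp := map_isPlanePair e
    fin_cases j <;> cases i
    all_goals
      simp only [LinearMap.comp_apply, word, Matrix.cons_val,
        Fin.zero_eta, Fin.mk_one, Fin.reduceFinMk, ydModule_act_gen, antipode_table e,
        map_smul, map_neg, map_zero,
        hT.act_one, hT.act_x, hT.act_y, hT.act_yx hp, hT.act_yy hx hp,
        hT.act_yyx hx hp, hT.act_yyy hx hp, hT.act_yyyx hx hp, pick]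
    all_goals match_scalars
    all_goals grind

theorem antipode_coact (r : R) : (antipode e).lTensor (HopfK hξ) (coact e hξ r) =
    coact e hξ (antipode e r) := by
  refine LinearMap.congr_fun
    (f := (antipode e).lTensor (HopfK hξ) ∘ₗ (coact e hξ).toLinearMap)
    (g := (coact e hξ).toLinearMap ∘ₗ antipode e)
    (map_linearMap_ext e fun j => ?_) r
  fin_cases j
  all_goals
    simp only [LinearMap.comp_apply, AlgHom.toLinearMap_apply, word, Matrix.cons_val,
      Fin.zero_eta, Fin.mk_one, Fin.reduceFinMk, antipode_table e, coact_table e hξ,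
      map_add, map_sub, map_smul, map_neg, LinearMap.lTensor_tmul, TensorProduct.tmul_smul,
      TensorProduct.tmul_neg]
  all_goals match_scalars
  all_goals grind

include hξ in
theorem antipode_left (r : R) : LinearMap.mul' k R ((antipode e).rTensor R (comul e r)) =
    algebraMap k R (counit e r) := by
  refine LinearMap.congr_fun
    (f := LinearMap.mul' k R ∘ₗ (antipode e).rTensor R ∘ₗ comul e)
    (g := Algebra.linearMap k R ∘ₗ (counit e).toLinearMap)
    (map_linearMap_ext e fun j => ?_) r
  have hx := xi_mul_xi hξ
  have h2 := two_ne_zero_of_root hξ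
  have hp := map_isPlanePair e
  fin_cases j
  all_goals
    simp only [LinearMap.comp_apply, AlgHom.toLinearMap_apply, word, Matrix.cons_val,
      Fin.zero_eta, Fin.mk_one, Fin.reduceFinMk, antipode_table e, comul_table e, map_mul,
      counit_x, counit_y, map_one, mul_zero, map_zero, Algebra.linearMap_apply,
      map_add, map_sub, map_smul, LinearMap.rTensor_tmul, LinearMap.mul'_apply, neg_mul, mul_assoc,
      smul_mul_assoc, mul_smul_comm, hp.xx, hp.xy, hp.xy_mul, mul_one, one_mul]
  all_goals match_scalars
  all_goals grind

include hξ in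
theorem antipode_right (r : R) : LinearMap.mul' k R ((antipode e).lTensor R (comul e r)) =
    algebraMap k R (counit e r) := by
  refine LinearMap.congr_fun
    (f := LinearMap.mul' k R ∘ₗ (antipode e).lTensor R ∘ₗ comul e)
    (g := Algebra.linearMap k R ∘ₗ (counit e).toLinearMap)
    (map_linearMap_ext e fun j => ?_) r
  have hx := xi_mul_xi hξ
  have h2 := two_ne_zero_of_root hξ
  have hp := map_isPlanePair e
  fin_cases j
  all_goals
    simp only [LinearMap.comp_apply, AlgHom.toLinearMap_apply, word, Matrix.cons_val,
      Fin.zero_eta, Fin.mk_one, Fin.reduceFinMk, antipode_table e, comul_table e, map_mul,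
      counit_x, counit_y, map_one, mul_zero, map_zero, Algebra.linearMap_apply,
      map_add, map_sub, map_smul, LinearMap.lTensor_tmul, LinearMap.mul'_apply, mul_neg, mul_assoc,
      smul_mul_assoc, mul_smul_comm, hp.xx, hp.xy, hp.xy_mul, mul_one, one_mul]
  all_goals match_scalars
  all_goals grind

/-- The braided Hopf algebra structure on the presented algebra. -/
def braidedHopfAlgebra : BraidedHopfAlgebra k (HopfK hξ) R where
  toYDModule := ydModule e hξ
  comul := comul e
  counit := counit e
  antipode := antipode e
  act_mul := (isAlgebra_ydModule e hξ).act_mul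
  act_one := (isAlgebra_ydModule e hξ).act_one
  coact_mul := (isAlgebra_ydModule e hξ).coact_mul
  coact_one := (isAlgebra_ydModule e hξ).coact_one
  comul_coassoc := comul_coassoc e hξ
  counit_left := counit_left e
  counit_right := counit_right e
  comul_act := comul_act e hξ
  comul_coact := comul_coact e hξ
  counit_act := counit_act e hξ
  counit_coact' := counit_coact e hξ
  comul_one := (comul_table e).1
  comul_mul := comul_mul e hξ
  antipode_isHom := ⟨antipode_act e hξ, antipode_coact e hξ⟩
  antipode_left := antipode_left e hξ
  antipode_right := antipode_right e hξ

end PlaneAlg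

namespace PlaneAlg

open HopfK

variable {k : Type u} [Field k] {ξ : k} {R : Type w} [Ring R] [Algebra k R]
  (e : PlaneAlg ξ ≃ₐ[k] R) (hξ : IsPrimitiveRoot ξ 4)

local notation "𝐱" => e (planeGen ξ 0)
local notation "𝐲" => e (planeGen ξ 1)

/-! ### The grading -/

/-- The degrees of the words. -/
def wordDeg : Fin 8 → ℕ := ![0, 1, 2, 3, 1, 2, 3, 4]

/-- The span of the words of degree `n`. -/
def grading (n : ℕ) : Submodule k R := Submodule.span k (word 𝐱 𝐲 '' {i | wordDeg i = n})

theorem word_mem_grading {n : ℕ} (i : Fin 8) (hi : wordDeg i = n) : word 𝐱 𝐲 i ∈ grading e n :=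
  Submodule.subset_span ⟨i, hi, rfl⟩

theorem word_mem_table : (1 : R) ∈ grading e 0 ∧ 𝐲 ∈ grading e 1 ∧ 𝐲 * 𝐲 ∈ grading e 2 ∧
    𝐲 * (𝐲 * 𝐲) ∈ grading e 3 ∧ 𝐱 ∈ grading e 1 ∧ 𝐲 * 𝐱 ∈ grading e 2 ∧
    𝐲 * (𝐲 * 𝐱) ∈ grading e 3 ∧ 𝐲 * (𝐲 * (𝐲 * 𝐱)) ∈ grading e 4 :=
  have h := fun i => word_mem_grading e i rfl
  ⟨h 0, h 1, h 2, h 3, h 4, h 5, h 6, h 7⟩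

/-- Reduces each graded statement below to the eight words; the family S is free, to allow shifted
degrees and targets other than R. -/
theorem map_mem_of_mem_grading {M : Type*} [AddCommGroup M] [Module k M] {f : R →ₗ[k] M}
    {S : ℕ → Submodule k M} (h : ∀ i, f (word 𝐱 𝐲 i) ∈ S (wordDeg i)) {n : ℕ} {r : R}
    (hr : r ∈ grading e n) : f r ∈ S n := by
  have : grading e n ≤ (S n).comap f := by
    rw [grading, Submodule.span_le]
    rintro _ ⟨i, rfl, rfl⟩
    exact h i
  exact this hr

/-- The word i + 4 has degree one more than the word i when i < 4; for the other indices the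
coefficient is zero. -/
theorem x_mul_mem {m n : ℕ} {r : R} (hr : r ∈ grading e n) (h : m = n + 1) :
    𝐱 * r ∈ grading e m := by
  subst h
  refine map_mem_of_mem_grading e (f := LinearMap.mulLeft k 𝐱) (S := fun n => grading e (n + 1))
    (fun i => ?_) hr
  rw [LinearMap.mulLeft_apply, map_x_mul_word]
  have hm := word_mem_grading e (n := wordDeg i + 1) (i + 4)
  fin_cases i <;> first
    | exact Submodule.smul_mem _ _ (hm rfl)
    | (rw [show ![1, ξ, ξ ^ 2, ξ ^ 3, 0, 0, 0, 0] _ = 0 from rfl, zero_smul]; exact zero_mem _)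

theorem y_mul_mem {m n : ℕ} {r : R} (hr : r ∈ grading e n) (h : m = n + 1) :
    𝐲 * r ∈ grading e m := by
  subst h
  refine map_mem_of_mem_grading e (f := LinearMap.mulLeft k 𝐲) (S := fun n => grading e (n + 1))
    (fun i => ?_) hr
  rw [LinearMap.mulLeft_apply, map_y_mul_word]
  have hm := word_mem_grading e (n := wordDeg i + 1) (i + 1)
  fin_cases i <;> first
    | exact Submodule.smul_mem _ _ (hm rfl)
    | (rw [show ![1, 1, 1, 0, 1, 1, 1, (0 : k)] _ = 0 from rfl, zero_smul]; exact zero_mem _)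

theorem gradedMonoid_grading : SetLike.GradedMonoid (grading e) where
  one_mem := (word_mem_table e).1
  mul_mem := by
    intro m n r s hr hs
    refine map_mem_of_mem_grading e (f := LinearMap.mulRight k s)
      (S := fun m => grading e (m + n)) (fun i => ?_) hr
    rw [LinearMap.mulRight_apply]
    -- Each word times s arises from s by at most one multiplication by x followed by
    -- multiplications by y.
    have h1 := y_mul_mem e hs rfl
    have h2 := y_mul_mem e h1 rfl
    have h4 := x_mul_mem e hs rfl
    have h5 := y_mul_mem e h4 rfl
    have h6 := y_mul_mem e h5 rfl
    have h3 := y_mul_mem e h2 rfl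
    have h7 := y_mul_mem e h6 rfl
    fin_cases i <;>
      simp only [word, wordDeg, Matrix.cons_val, Fin.zero_eta, Fin.mk_one, Fin.reduceFinMk,
        mul_assoc, one_mul, zero_add, add_comm _ n] <;> assumption

/-- The decomposition of an element into homogeneous components. -/
def decomposeMap : R →ₗ[k] DirectSum ℕ fun n => grading e n :=
  (mapBasis e).constr k fun i =>
    DirectSum.lof k ℕ (fun n => grading e n) (wordDeg i) ⟨word 𝐱 𝐲 i, word_mem_grading e i rfl⟩

theorem decomposeMap_word (i : Fin 8) : decomposeMap e (word 𝐱 𝐲 i) =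
    DirectSum.lof k ℕ (fun n => grading e n) (wordDeg i)
      ⟨word 𝐱 𝐲 i, word_mem_grading e i rfl⟩ := by
  have := (mapBasis e).constr_basis k (fun i => DirectSum.lof k ℕ (fun n => grading e n)
    (wordDeg i) ⟨word 𝐱 𝐲 i, word_mem_grading e i rfl⟩) i
  rwa [mapBasis_apply] at this

/-- Sending each word to itself in the summand of its degree inverts the summation map. -/
theorem isInternal_grading : DirectSum.IsInternal (grading e) := by
  have hl : DirectSum.coeLinearMap (grading e) ∘ₗ decomposeMap e = LinearMap.id := by
    refine map_linearMap_ext e fun i => ?_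
    rw [LinearMap.comp_apply, decomposeMap_word, DirectSum.coeLinearMap_lof]
    rfl
  have hr : decomposeMap e ∘ₗ DirectSum.coeLinearMap (grading e) = LinearMap.id := by
    refine DirectSum.linearMap_ext k fun n => LinearMap.ext fun r => ?_
    simp only [LinearMap.comp_apply, DirectSum.coeLinearMap_lof, LinearMap.id_apply]
    obtain ⟨r, hr⟩ := r
    induction hr using Submodule.span_induction with
    | mem s hs => obtain ⟨i, rfl, rfl⟩ := hs; exact decomposeMap_word e i
    | zero => rw [map_zero]; exact (map_zero _).symm
    | add s t hs ht hs' ht' =>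
      rw [map_add, hs', ht', ← map_add]
      rfl
    | smul c s hs hs' =>
      rw [map_smul, hs', ← map_smul]
      rfl
  exact ⟨Function.LeftInverse.injective (g := decomposeMap e) (LinearMap.congr_fun hr),
    Function.RightInverse.surjective (g := decomposeMap e) (LinearMap.congr_fun hl)⟩

theorem act_mem_grading (n : ℕ) (h : HopfK hξ) (r : R) (hr : r ∈ grading e n) :
    (ydModule e hξ).act h r ∈ grading e n := by
  induction h using HopfK.induction generalizing r with
  | algebraMap c =>
    rw [AlgHom.commutes, Module.algebraMap_end_apply]
    exact Submodule.smul_mem _ _ hr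
  | mul x y hX hY => rw [map_mul]; exact hX _ (hY _ hr)
  | add x y hX hY => rw [map_add]; exact add_mem (hX _ hr) (hY _ hr)
  | gen i =>
    refine map_mem_of_mem_grading e (f := (ydModule e hξ).act (gen hξ i)) (fun j => ?_) hr
    have hx := xi_mul_xi hξ
    have hT := isWordAct_actGen e hξ
    have hp := map_isPlanePair e
    obtain ⟨h0, h1, h2, h3, h4, h5, h6, h7⟩ := word_mem_table e
    rw [ydModule_act_gen]
    fin_cases j <;> cases i
    all_goals
      simp only [word, wordDeg, Matrix.cons_val, Fin.zero_eta, Fin.mk_one, Fin.reduceFinMk,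
        hT.act_one, hT.act_x, hT.act_y, hT.act_yx hp, hT.act_yy hx hp,
        hT.act_yyx hx hp, hT.act_yyy hx hp, hT.act_yyyx hx hp, pick]
    all_goals repeat' first
      | assumption
      | apply zero_mem
      | apply neg_mem
      | apply Submodule.smul_mem

theorem tmul_mem_lTensor {n : ℕ} {r : R} (h : HopfK hξ) (hr : r ∈ grading e n) :
    h ⊗ₜ[k] r ∈ LinearMap.range ((grading e n).subtype.lTensor (HopfK hξ)) :=
  ⟨h ⊗ₜ ⟨r, hr⟩, rfl⟩

theorem coact_mem_grading (n : ℕ) (r : R) (hr : r ∈ grading e n) :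
    coact e hξ r ∈ LinearMap.range ((grading e n).subtype.lTensor (HopfK hξ)) := by
  refine map_mem_of_mem_grading e (f := (coact e hξ).toLinearMap)
    (S := fun n => LinearMap.range ((grading e n).subtype.lTensor (HopfK hξ))) (fun j => ?_) hr
  obtain ⟨h0, h1, h2, h3, h4, h5, h6, h7⟩ := word_mem_table e
  rw [AlgHom.toLinearMap_apply]
  fin_cases j
  all_goals
    simp only [word, wordDeg, Matrix.cons_val, Fin.zero_eta, Fin.mk_one, Fin.reduceFinMk,
      coact_table e hξ]
  all_goals repeat' first
    | assumption
    | apply add_mem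
    | apply sub_mem
    | apply Submodule.smul_mem
    | apply tmul_mem_lTensor

theorem tmul_mem_iSup {p q n : ℕ} {r s : R} (hr : r ∈ grading e p) (hs : s ∈ grading e q)
    (h : p + q = n) :
    r ⊗ₜ[k] s ∈ ⨆ p ∈ Finset.HasAntidiagonal.antidiagonal n,
      LinearMap.range (TensorProduct.map (grading e p.1).subtype (grading e p.2).subtype) :=
  Submodule.mem_iSup_of_mem (p, q) (Submodule.mem_iSup_of_mem (by simpa using h)
    ⟨⟨r, hr⟩ ⊗ₜ ⟨s, hs⟩, rfl⟩)

theorem comul_mem_grading (n : ℕ) (r : R) (hr : r ∈ grading e n) :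
    comul e r ∈ ⨆ p ∈ Finset.HasAntidiagonal.antidiagonal n,
      LinearMap.range (TensorProduct.map (grading e p.1).subtype (grading e p.2).subtype) := by
  refine map_mem_of_mem_grading e (f := comul e)
    (S := fun n => ⨆ p ∈ Finset.HasAntidiagonal.antidiagonal n,
      LinearMap.range (TensorProduct.map (grading e p.1).subtype (grading e p.2).subtype))
    (fun j => ?_) hr
  obtain ⟨h0, h1, h2, h3, h4, h5, h6, h7⟩ := word_mem_table e
  fin_cases j
  all_goals
    simp only [word, wordDeg, Matrix.cons_val, Fin.zero_eta, Fin.mk_one, Fin.reduceFinMk,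
      comul_table e]
  all_goals repeat' first
    | (apply tmul_mem_iSup e <;> first | assumption | rfl)
    | apply add_mem
    | apply sub_mem
    | apply Submodule.smul_mem

theorem counit_of_mem_grading (n : ℕ) (r : R) (hn : n ≠ 0) (hr : r ∈ grading e n) :
    counit e r = 0 := by
  -- Vanishing in nonzero degree is phrased as membership in the family that is ⊤ in degree 0 and ⊥
  -- elsewhere.
  refine map_mem_of_mem_grading e (f := (counit e).toLinearMap)
    (S := fun n => if n = 0 then ⊤ else ⊥) (fun j => ?_) hr |> fun h => by simpa [hn] using h
  fin_cases j <;> simp [word, wordDeg, counit_x, counit_y]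

theorem antipode_mem_grading (n : ℕ) (r : R) (hr : r ∈ grading e n) :
    antipode e r ∈ grading e n := by
  refine map_mem_of_mem_grading e (f := antipode e) (fun j => ?_) hr
  obtain ⟨h0, h1, h2, h3, h4, h5, h6, h7⟩ := word_mem_table e
  fin_cases j
  all_goals
    simp only [word, wordDeg, Matrix.cons_val, Fin.zero_eta, Fin.mk_one, Fin.reduceFinMk,
      antipode_table e]
  all_goals repeat' first
    | assumption
    | apply neg_mem
    | apply Submodule.smul_mem

theorem finrank_grading_zero : Module.finrank k (grading e 0) = 1 := by
  have h : {i | wordDeg i = 0} = {0} := by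
    ext i
    fin_cases i <;> simp [wordDeg]
  have : Nontrivial R := (mapBasis e).repr.toEquiv.nontrivial
  rw [grading, h, Set.image_singleton]
  exact finrank_span_singleton (one_ne_zero (α := R))

end PlaneAlg

/-- The operator `(id ⊗ φ) ∘ Δ`. -/
def skewDeriv {k : Type u} [Field k] {R : Type w} [AddCommGroup R] [Module k R]
    (Δ : R →ₗ[k] R ⊗[k] R) (φ : R →ₗ[k] k) : R →ₗ[k] R :=
  (TensorProduct.rid k R).toLinearMap ∘ₗ φ.lTensor R ∘ₗ Δ

namespace PlaneAlg

open HopfK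

variable {k : Type u} [Field k] {ξ : k} {R : Type w} [Ring R] [Algebra k R]
  (e : PlaneAlg ξ ≃ₐ[k] R) (hξ : IsPrimitiveRoot ξ 4)

local notation "𝐱" => e (planeGen ξ 0)
local notation "𝐲" => e (planeGen ξ 1)

/-! ### Skew derivations -/

/-- The skew derivation `∂/∂x`. -/
def derivX : R →ₗ[k] R := skewDeriv (comul e) ((mapBasis e).coord 4)

/-- The skew derivation `∂/∂y`. -/
def derivY : R →ₗ[k] R := skewDeriv (comul e) ((mapBasis e).coord 1)

theorem coord_word (i j : Fin 8) : (mapBasis e).coord i (word 𝐱 𝐲 j) = if j = i then 1 else 0 := by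
  rw [← mapBasis_apply, Module.Basis.coord_apply, Module.Basis.repr_self, Finsupp.single_apply]

theorem coord_table (i : Fin 8) :
    (mapBasis e).coord i 1 = (if 0 = i then 1 else 0) ∧
    (mapBasis e).coord i 𝐲 = (if 1 = i then 1 else 0) ∧
    (mapBasis e).coord i (𝐲 * 𝐲) = (if 2 = i then 1 else 0) ∧
    (mapBasis e).coord i (𝐲 * (𝐲 * 𝐲)) = (if 3 = i then 1 else 0) ∧
    (mapBasis e).coord i 𝐱 = (if 4 = i then 1 else 0) ∧
    (mapBasis e).coord i (𝐲 * 𝐱) = (if 5 = i then 1 else 0) ∧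
    (mapBasis e).coord i (𝐲 * (𝐲 * 𝐱)) = (if 6 = i then 1 else 0) ∧
    (mapBasis e).coord i (𝐲 * (𝐲 * (𝐲 * 𝐱))) = (if 7 = i then 1 else 0) :=
  have h := coord_word e i
  ⟨h 0, h 1, h 2, h 3, h 4, h 5, h 6, h 7⟩

theorem derivX_word (i : Fin 8) : derivX e (word 𝐱 𝐲 i) =
    ![0, 0, ((ξ - 1) / 2) • 𝐱, ((1 + ξ) / 2) • (𝐲 * 𝐱), 1, 𝐲, 𝐲 * 𝐲, 𝐲 * (𝐲 * 𝐲)] i := by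
  fin_cases i <;> simp [word, derivX, skewDeriv, comul_table e, coord_table e]

/-- On powers of y this is ∂y(yⁿ) = (1 + q + … + qⁿ⁻¹) yⁿ⁻¹ with q = -ξ. -/
theorem derivY_word (i : Fin 8) : derivY e (word 𝐱 𝐲 i) =
    ![0, 1, (1 - ξ) • 𝐲, -ξ • (𝐲 * 𝐲), 0, -𝐱, (ξ - 1) • (𝐲 * 𝐱), ξ • (𝐲 * (𝐲 * 𝐱))] i := by
  fin_cases i <;> simp [word, derivY, skewDeriv, comul_table e, coord_table e]

theorem derivX_table :
    derivX e 1 = 0 ∧ derivX e 𝐲 = 0 ∧ derivX e (𝐲 * 𝐲) = ((ξ - 1) / 2) • 𝐱 ∧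
    derivX e (𝐲 * (𝐲 * 𝐲)) = ((1 + ξ) / 2) • (𝐲 * 𝐱) ∧ derivX e 𝐱 = 1 ∧
    derivX e (𝐲 * 𝐱) = 𝐲 ∧ derivX e (𝐲 * (𝐲 * 𝐱)) = 𝐲 * 𝐲 ∧
    derivX e (𝐲 * (𝐲 * (𝐲 * 𝐱))) = 𝐲 * (𝐲 * 𝐲) :=
  have h := derivX_word e
  ⟨h 0, h 1, h 2, h 3, h 4, h 5, h 6, h 7⟩

theorem derivY_table :
    derivY e 1 = 0 ∧ derivY e 𝐲 = 1 ∧ derivY e (𝐲 * 𝐲) = (1 - ξ) • 𝐲 ∧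
    derivY e (𝐲 * (𝐲 * 𝐲)) = -ξ • (𝐲 * 𝐲) ∧ derivY e 𝐱 = 0 ∧
    derivY e (𝐲 * 𝐱) = -𝐱 ∧ derivY e (𝐲 * (𝐲 * 𝐱)) = (ξ - 1) • (𝐲 * 𝐱) ∧
    derivY e (𝐲 * (𝐲 * (𝐲 * 𝐱))) = ξ • (𝐲 * (𝐲 * 𝐱)) :=
  have h := derivY_word e
  ⟨h 0, h 1, h 2, h 3, h 4, h 5, h 6, h 7⟩

/-- The coordinates are, up to units, counits of iterated skew derivatives. -/
theorem counit_deriv (i : Fin 8) (r : R) :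
    ![counit e r, counit e (derivY e r), counit e (derivY e (derivY e r)),
      counit e (derivY e (derivY e (derivY e r))), counit e (derivX e r),
      counit e (derivY e (derivX e r)), counit e (derivY e (derivY e (derivX e r))),
      counit e (derivY e (derivY e (derivY e (derivX e r))))] i =
    ![1, 1, 1 - ξ, -ξ * (1 - ξ), 1, 1, 1 - ξ, -ξ * (1 - ξ)] i * (mapBasis e).coord i r := by
  -- An equality of two linear forms, hence tested on words. Applying ∂x first turns yʲx into yʲ;
  -- what it leaves of y² and y³ ends in x, and never reaches a nonzero scalar under powers of ∂y.
  have h : ∀ D : R →ₗ[k] R, ∀ c : k, (∀ j, counit e (D (word 𝐱 𝐲 j)) =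
      c * (mapBasis e).coord i (word 𝐱 𝐲 j)) → counit e (D r) = c * (mapBasis e).coord i r :=
    fun D c hD => LinearMap.congr_fun (f := (counit e).toLinearMap ∘ₗ D)
      (g := c • (mapBasis e).coord i) (map_linearMap_ext e hD) r
  fin_cases i
  · refine h LinearMap.id _ fun j => ?_
    fin_cases j <;> simp [word, counit_x, counit_y, coord_table e]
  · refine h (derivY e) _ fun j => ?_
    fin_cases j <;> simp [word, counit_x, counit_y, coord_table e, derivY_table e]
  · refine h (derivY e ∘ₗ derivY e) _ fun j => ?_
    fin_cases j <;> simp [word, counit_x, counit_y, coord_table e, derivY_table e]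
  · refine h (derivY e ∘ₗ derivY e ∘ₗ derivY e) _ fun j => ?_
    fin_cases j <;> simp [word, counit_x, counit_y, coord_table e, derivY_table e]
  · refine h (derivX e) _ fun j => ?_
    fin_cases j <;> simp [word, counit_x, counit_y, coord_table e, derivX_table e]
  · refine h (derivY e ∘ₗ derivX e) _ fun j => ?_
    fin_cases j <;> simp [word, counit_x, counit_y, coord_table e, derivX_table e, derivY_table e]
  · refine h (derivY e ∘ₗ derivY e ∘ₗ derivX e) _ fun j => ?_
    fin_cases j <;> simp [word, counit_x, counit_y, coord_table e, derivX_table e, derivY_table e]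
  · refine h (derivY e ∘ₗ derivY e ∘ₗ derivY e ∘ₗ derivX e) _ fun j => ?_
    fin_cases j <;> simp [word, counit_x, counit_y, coord_table e, derivX_table e, derivY_table e]

-- The constants are the quantum factorials of 0, 1, 2, 3 at q = -ξ, nonzero because ξ is neither 0
-- nor 1.
include hξ in
theorem derivCoeff_ne_zero (i : Fin 8) :
    ![1, 1, 1 - ξ, -ξ * (1 - ξ), 1, 1, 1 - ξ, -ξ * (1 - ξ)] i ≠ 0 := by
  have h1 : ξ ≠ 0 := hξ.ne_zero (by norm_num)
  have h2 : 1 - ξ ≠ 0 := sub_ne_zero.mpr (hξ.ne_one (by norm_num)).symm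
  fin_cases i <;> simp [h1, h2]

include hξ in
theorem coord_eq_zero_of_counit_deriv {i : Fin 8} {r : R}
    (h : ![counit e r, counit e (derivY e r), counit e (derivY e (derivY e r)),
      counit e (derivY e (derivY e (derivY e r))), counit e (derivX e r),
      counit e (derivY e (derivX e r)), counit e (derivY e (derivY e (derivX e r))),
      counit e (derivY e (derivY e (derivY e (derivX e r))))] i = 0) :
    (mapBasis e).coord i r = 0 := by
  rw [counit_deriv] at h
  exact (mul_eq_zero.mp h).resolve_left (derivCoeff_ne_zero hξ i)

include hξ in
/-- A subspace in the kernel of the counit that is stable under the skew derivations is zero. -/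
theorem eq_zero_of_mem_of_deriv_mem {S : Submodule k R} (h0 : ∀ r ∈ S, counit e r = 0)
    (hx : ∀ r ∈ S, derivX e r ∈ S) (hy : ∀ r ∈ S, derivY e r ∈ S) {r : R} (hr : r ∈ S) : r = 0 := by
  refine (mapBasis e).ext_elem fun i => ?_
  rw [map_zero, Finsupp.zero_apply]
  refine coord_eq_zero_of_counit_deriv e hξ (i := i) ?_
  fin_cases i
  exacts [h0 _ hr, h0 _ (hy _ hr), h0 _ (hy _ (hy _ hr)), h0 _ (hy _ (hy _ (hy _ hr))),
    h0 _ (hx _ hr), h0 _ (hy _ (hx _ hr)), h0 _ (hy _ (hy _ (hx _ hr))),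
    h0 _ (hy _ (hy _ (hy _ (hx _ hr))))]

/-! ### The Nichols algebra -/

theorem grading_one : grading e 1 = Submodule.span k {𝐱, 𝐲} := by
  have h : {i | wordDeg i = 1} = {4, 1} := by
    ext i
    fin_cases i <;> simp [wordDeg]
  rw [grading, h, Set.image_pair]
  rfl

-- For the converse, a primitive element has counit zero and scalar first derivatives, so every
-- coordinate other than those at x and y vanishes.
include hξ in
theorem primitive_iff (r : R) : r ∈ grading e 1 ↔ comul e r = r ⊗ₜ[k] 1 + 1 ⊗ₜ[k] r := by
  constructor
  · intro hr
    rw [grading_one] at hr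
    induction hr using Submodule.span_induction with
    | mem s hs =>
      rcases hs with rfl | rfl
      exacts [(comul_table e).2.2.2.2.1, (comul_table e).2.1]
    | zero => simp
    | add s t _ _ hs ht =>
      rw [map_add, hs, ht, TensorProduct.add_tmul, TensorProduct.tmul_add]
      abel
    | smul c s _ hs =>
      rw [map_smul, hs, smul_add, TensorProduct.smul_tmul', TensorProduct.tmul_smul]
  · intro hr
    -- The counit axiom applied to r ⊗ 1 + 1 ⊗ r reads ε(r) 1 + r = r.
    have hε : counit e r = 0 := by
      have := counit_left e r
      simp only [hr, map_add, LinearMap.rTensor_tmul, TensorProduct.lid_tmul, AlgHom.toLinearMap_apply,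
        map_one, one_smul, add_eq_right] at this
      have h := congrArg (counit e) this
      simpa using h
    -- For a form φ, (id ⊗ φ)(r ⊗ 1 + 1 ⊗ r) = φ(1) r + φ(r) 1, and coordinate 4 vanishes at 1;
    -- likewise for coordinate 1 below.
    have hX : derivX e r = (mapBasis e).coord 4 r • 1 := by
      simp [derivX, skewDeriv, hr, coord_table e]
    have hY : derivY e r = (mapBasis e).coord 1 r • 1 := by
      simp [derivY, skewDeriv, hr, coord_table e]
    have hc : ∀ i, i ≠ 4 → i ≠ 1 → (mapBasis e).coord i r = 0 := by
      intro i h4 h1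
      refine coord_eq_zero_of_counit_deriv e hξ (i := i) ?_
      fin_cases i
      case _ => exact hε
      case _ => exact absurd rfl h1
      case _ => simp [hY, derivY_table e]
      case _ => simp [hY, derivY_table e]
      case _ => exact absurd rfl h4
      all_goals simp [hX, derivY_table e]
    rw [← (mapBasis e).sum_repr r]
    refine Submodule.sum_mem _ fun i _ => ?_
    by_cases h4 : i = 4
    · subst h4
      exact Submodule.smul_mem _ _ (mapBasis_apply e 4 ▸ (word_mem_table e).2.2.2.2.1)
    by_cases h1 : i = 1
    · subst h1
      exact Submodule.smul_mem _ _ (mapBasis_apply e 1 ▸ (word_mem_table e).2.1)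
    rw [← Module.Basis.coord_apply, hc i h4 h1, zero_smul]
    exact zero_mem _

/-- The inclusion of `V_{2,3}` in the presented algebra. -/
def incl : (Fin 2 → k) →ₗ[k] R := (Pi.basisFun k (Fin 2)).constr k ![𝐱, 𝐲]

theorem incl_zero : incl e (Pi.single 0 1) = 𝐱 := by
  have := (Pi.basisFun k (Fin 2)).constr_basis k ![𝐱, 𝐲] 0
  rwa [Pi.basisFun_apply] at this

theorem incl_one : incl e (Pi.single 1 1) = 𝐲 := by
  have := (Pi.basisFun k (Fin 2)).constr_basis k ![𝐱, 𝐲] 1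
  rwa [Pi.basisFun_apply] at this

theorem isHom_incl : (v23 hξ).IsHom (ydModule e hξ) (incl e) where
  map_act h m := by
    change incl e (v23Act hξ h m) = _
    induction h using HopfK.induction generalizing m with
    | algebraMap c => simp [Module.algebraMap_end_apply]
    | mul x y hX hY => rw [map_mul, map_mul, Module.End.mul_apply, hX, hY]; rfl
    | add x y hX hY => simp only [map_add, LinearMap.add_apply, hX, hY]
    | gen i =>
      refine LinearMap.congr_fun (f := incl e ∘ₗ v23Act hξ (gen hξ i))
        (g := (ydModule e hξ).act (gen hξ i) ∘ₗ incl e) (hom_ext_two ?_ ?_) m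
      · rw [LinearMap.comp_apply, LinearMap.comp_apply, v23Act_zero, incl_zero, ydModule_act_gen,
          (isWordAct_actGen e hξ).act_x]
        cases i <;> simp [pick, incl_zero]
      · rw [LinearMap.comp_apply, LinearMap.comp_apply, v23Act_one, incl_one, ydModule_act_gen,
          (isWordAct_actGen e hξ).act_y]
        cases i <;> simp [pick, incl_zero, incl_one]
  map_coact m := by
    refine LinearMap.congr_fun (f := (incl e).lTensor (HopfK hξ) ∘ₗ v23Coact hξ)
      (g := (coact e hξ).toLinearMap ∘ₗ incl e) (hom_ext_two ?_ ?_) m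
    · simp [v23Coact_zero, incl_zero, incl_one, coact_table e hξ]
    · simp [v23Coact_one, incl_zero, incl_one, coact_table e hξ]

theorem incl_injective : Function.Injective (incl e) := by
  have h : LinearMap.pi ![(mapBasis e).coord 4, (mapBasis e).coord 1] ∘ₗ incl e =
      LinearMap.id := by
    refine hom_ext_two ?_ ?_
    · ext i
      fin_cases i <;> simp [incl_zero, coord_table e]
    · ext i
      fin_cases i <;> simp [incl_one, coord_table e]
  exact Function.LeftInverse.injective
    (g := LinearMap.pi ![(mapBasis e).coord 4, (mapBasis e).coord 1]) (LinearMap.congr_fun h)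

theorem range_incl : LinearMap.range (incl e) = grading e 1 := by
  rw [incl, Module.Basis.constr_range, grading_one, Matrix.range_cons, Matrix.range_cons,
    Matrix.range_empty, Set.union_empty, Set.singleton_union]

theorem adjoin_grading_one : Algebra.adjoin k (grading e 1 : Set R) = ⊤ := by
  refine top_unique fun r _ => ?_
  induction r using map_mul_induction e with
  | algebraMap r => exact Subalgebra.algebraMap_mem _ r
  | x => exact Algebra.subset_adjoin (word_mem_table e).2.2.2.2.1
  | y => exact Algebra.subset_adjoin (word_mem_table e).2.1
  | mul r s hr hs => exact mul_mem (hr trivial) (hs trivial)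
  | add r s hr hs => exact add_mem (hr trivial) (hs trivial)

/-- The presented algebra as the Nichols algebra of `V_{2,3}`. -/
def nicholsAlgebra : NicholsAlgebra (v23 hξ) R where
  toBraidedHopfAlgebra := braidedHopfAlgebra e hξ
  grading := grading e
  gradedMonoid := gradedMonoid_grading e
  isInternal := isInternal_grading e
  act_mem := act_mem_grading e hξ
  coact_mem := coact_mem_grading e hξ
  comul_mem := comul_mem_grading e
  counit_mem := counit_of_mem_grading e
  antipode_mem := antipode_mem_grading e
  finrank_zero := finrank_grading_zero e
  ι := incl e
  ι_isHom := isHom_incl e hξ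
  ι_injective := incl_injective e
  range_ι := range_incl e
  primitive_iff := primitive_iff e hξ
  adjoin_eq_top := adjoin_grading_one e

end PlaneAlg

/-! ### Uniqueness -/

namespace NicholsAlgebra

open HopfK

variable {k : Type u} [Field k] {ξ : k} {hξ : IsPrimitiveRoot ξ 4} {R : Type w} [Ring R]
  [Algebra k R] (N : NicholsAlgebra (v23 hξ) R)

theorem isAlgebra : N.toYDModule.IsAlgebra :=
  ⟨N.act_mul, N.act_one, N.coact_mul, N.coact_one⟩

/-- The element of `R(1)` corresponding to `e₁`. -/
def x : R := N.ι (Pi.single 0 1)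

/-- The element of `R(1)` corresponding to `e₂`. -/
def y : R := N.ι (Pi.single 1 1)

theorem act_ι (h : HopfK hξ) (v : Fin 2 → k) : N.act h (N.ι v) = N.ι (v23Act hξ h v) :=
  (N.ι_isHom.map_act h v).symm

theorem coact_ι (v : Fin 2 → k) : N.coact (N.ι v) = N.ι.lTensor (HopfK hξ) (v23Coact hξ v) :=
  (N.ι_isHom.map_coact v).symm

theorem act_x (i : KGen) : N.act (gen hξ i) N.x = pick (-N.x) 0 0 (-N.x) i := by
  rw [x, act_ι, v23Act_zero]
  cases i <;> simp [pick]

theorem act_y (i : KGen) : N.act (gen hξ i) N.y = pick (ξ • N.y) N.x N.x (-ξ • N.y) i := by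
  rw [x, y, act_ι, v23Act_one]
  cases i <;> simp [pick]

theorem coact_x : N.coact N.x = gen hξ .a ⊗ₜ N.x - (1 + ξ) • (gen hξ .b ⊗ₜ N.y) := by
  rw [x, coact_ι, v23Coact_zero]
  simp [y]

theorem coact_y : N.coact N.y = gen hξ .d ⊗ₜ N.y + ((ξ - 1) / 2) • (gen hξ .c ⊗ₜ N.x) := by
  rw [y, coact_ι, v23Coact_one]
  simp [x]

theorem ι_mem (v : Fin 2 → k) : N.ι v ∈ N.grading 1 := N.range_ι ▸ LinearMap.mem_range_self _ v

theorem comul_x : N.comul N.x = N.x ⊗ₜ 1 + 1 ⊗ₜ N.x := (N.primitive_iff _).mp (N.ι_mem _)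

theorem comul_y : N.comul N.y = N.y ⊗ₜ 1 + 1 ⊗ₜ N.y := (N.primitive_iff _).mp (N.ι_mem _)

theorem act_gen_mul (i : KGen) (r s : R) : N.act (gen hξ i) (r * s) =
    pick (N.act (gen hξ .a) r * N.act (gen hξ .a) s + N.act (gen hξ .b) r * N.act (gen hξ .c) s)
      (N.act (gen hξ .a) r * N.act (gen hξ .b) s + N.act (gen hξ .b) r * N.act (gen hξ .d) s)
      (N.act (gen hξ .c) r * N.act (gen hξ .a) s + N.act (gen hξ .d) r * N.act (gen hξ .c) s)
      (N.act (gen hξ .c) r * N.act (gen hξ .b) s + N.act (gen hξ .d) r * N.act (gen hξ .d) s)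
      i := by
  have := N.act_mul (gen hξ i) (r ⊗ₜ s)
  rw [LinearMap.mul'_apply, tensorAct_gen] at this
  rw [this]
  cases i <;> simp [pick]

theorem isWordAct : IsWordAct ξ (fun i => N.act (gen hξ i)) N.x N.y where
  act_one i := by
    rw [N.act_one, counit_gen]
    cases i <;> simp [pick]
  act_x i := N.act_x i
  act_y_mul i s := by
    rw [act_gen_mul]
    cases i <;> simp [pick, act_y, sub_eq_add_neg]

theorem comul_x_mul (s : R) :
    N.comul (N.x * s) = comulMulX ξ (fun i => N.act (gen hξ i)) N.x N.y (N.comul s) := by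
  rw [← braidedMul_x N.isAlgebra N.coact_x, ← N.comul_x]
  exact N.comul_mul _ _

theorem comul_y_mul (s : R) :
    N.comul (N.y * s) = comulMulY ξ (fun i => N.act (gen hξ i)) N.x N.y (N.comul s) := by
  rw [← braidedMul_y N.isAlgebra N.coact_y, ← N.comul_y]
  exact N.comul_mul _ _

/-- A primitive homogeneous element of degree at least two vanishes. -/
theorem eq_zero_of_primitive {n : ℕ} (hn : n ≠ 1) {r : R} (hr : r ∈ N.grading n)
    (h : N.comul r = r ⊗ₜ[k] 1 + 1 ⊗ₜ[k] r) : r = 0 :=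
  Submodule.disjoint_def.mp (N.isInternal.submodule_iSupIndep.pairwiseDisjoint hn) r hr
    ((N.primitive_iff r).mpr h)

theorem mul_mem {m n : ℕ} {r s : R} (hr : r ∈ N.grading m) (hs : s ∈ N.grading n) :
    r * s ∈ N.grading (m + n) :=
  have := N.gradedMonoid
  SetLike.mul_mem_graded hr hs

/-- Both x² and xy - ξyx are primitive of degree two. -/
theorem isPlanePair : IsPlanePair ξ N.x N.y := by
  have hX : N.x ∈ N.grading 1 := N.ι_mem _
  have hY : N.y ∈ N.grading 1 := N.ι_mem _
  refine ⟨N.eq_zero_of_primitive (n := 2) (by norm_num) (N.mul_mem hX hX) ?_, sub_eq_zero.mp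
    (N.eq_zero_of_primitive (n := 2) (by norm_num) (sub_mem (N.mul_mem hX hY)
      (Submodule.smul_mem _ _ (N.mul_mem hY hX))) ?_)⟩
  · rw [comul_x_mul, N.comul_x]
    exact N.isWordAct.comulMulX_x
  · rw [map_sub, map_smul, comul_x_mul, comul_y_mul, comul_x, comul_y]
    exact N.isWordAct.comulMul_xy

/-- With the quadratic relations in hand, Δ(y³) is the tabulated value, and one more factor y shows
that y⁴ is primitive of degree four. -/
theorem yyyy : N.y * (N.y * (N.y * N.y)) = 0 := by
  have hx := xi_mul_xi hξ
  have h2 := two_ne_zero_of_root hξ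
  have hT := N.isWordAct
  have hp := N.isPlanePair
  have hY : N.y ∈ N.grading 1 := N.ι_mem _
  refine N.eq_zero_of_primitive (n := 4) (by norm_num)
    (N.mul_mem hY (N.mul_mem hY (N.mul_mem hY hY))) ?_
  have h1 : N.comul N.y = comulTable ξ N.x N.y 1 := N.comul_y
  rw [comul_y_mul, comul_y_mul, comul_y_mul, h1,
    hT.comulMulY_table hx h2 hp 1 (by decide) (by decide),
    hT.comulMulY_table hx h2 hp (1 + 1) (by decide) (by decide)]
  exact hT.comulMulY_yyy hx hp

theorem comul_word (i : Fin 8) :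
    N.comul (PlaneAlg.word N.x N.y i) = comulTable ξ N.x N.y i := by
  have hx := xi_mul_xi hξ
  have h2 := two_ne_zero_of_root hξ
  have hT := N.isWordAct
  have hp := N.isPlanePair
  have step : ∀ (i : Fin 8) (r : R), i ≠ 3 → i ≠ 7 → N.comul r = comulTable ξ N.x N.y i →
      N.comul (N.y * r) = comulTable ξ N.x N.y (i + 1) := by
    intro i r h3 h7 hr
    rw [comul_y_mul, hr]
    exact hT.comulMulY_table hx h2 hp i h3 h7
  have h1 := N.comul_y
  have h2 := step 1 _ (by decide) (by decide) h1
  have h3 := step 2 _ (by decide) (by decide) h2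
  have h4 := N.comul_x
  have h5 := step 4 _ (by decide) (by decide) h4
  have h6 := step 5 _ (by decide) (by decide) h5
  have h7 := step 6 _ (by decide) (by decide) h6
  fin_cases i
  exacts [N.comul_one, h1, h2, h3, h4, h5, h6, h7]

theorem word_mem (i : Fin 8) : PlaneAlg.word N.x N.y i ∈ N.grading (PlaneAlg.wordDeg i) := by
  have h1 : N.y ∈ N.grading 1 := N.ι_mem _
  have h4 : N.x ∈ N.grading 1 := N.ι_mem _
  have h2 := N.mul_mem h1 h1
  have h5 := N.mul_mem h1 h4
  have h6 := N.mul_mem h1 h5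
  fin_cases i
  exacts [N.gradedMonoid.one_mem, h1, h2, N.mul_mem h1 h2, h4, h5, h6, N.mul_mem h1 h6]

/-- The algebra map from the presented algebra. -/
def ofPlane : PlaneAlg ξ →ₐ[k] R := PlaneAlg.lift N.isPlanePair N.yyyy

theorem ofPlane_x : N.ofPlane (planeGen ξ 0) = N.x := PlaneAlg.lift_gen _ _ 0

theorem ofPlane_y : N.ofPlane (planeGen ξ 1) = N.y := PlaneAlg.lift_gen _ _ 1

theorem ofPlane_surjective : Function.Surjective N.ofPlane := by
  rw [← AlgHom.range_eq_top, ← top_le_iff, ← N.adjoin_eq_top, Algebra.adjoin_le_iff, ← N.range_ι]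
  rintro _ ⟨v, rfl⟩
  rw [← (Pi.basisFun k (Fin 2)).sum_repr v]
  simp only [Fin.sum_univ_two, Pi.basisFun_apply, map_add, map_smul]
  exact add_mem (Subalgebra.smul_mem _ (AlgHom.mem_range _ |>.mpr ⟨_, N.ofPlane_x⟩) _)
    (Subalgebra.smul_mem _ (AlgHom.mem_range _ |>.mpr ⟨_, N.ofPlane_y⟩) _)

/-- Every linear form on `V_{2,3}` extends to `R` by zero on the other homogeneous components. -/
theorem exists_linearForm (c : (Fin 2 → k) →ₗ[k] k) : ∃ φ : R →ₗ[k] k,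
    (∀ v, φ (N.ι v) = c v) ∧ ∀ n r, n ≠ 1 → r ∈ N.grading n → φ r = 0 := by
  let := N.isInternal.chooseDecomposition
  obtain ⟨g, hg⟩ := LinearMap.exists_leftInverse_of_injective N.ι
    (LinearMap.ker_eq_bot.mpr N.ι_injective)
  -- Project onto R(1), undo ι by its linear left inverse g, then apply c.
  refine ⟨c ∘ₗ g ∘ₗ (N.grading 1).subtype ∘ₗ DirectSum.component k ℕ _ 1 ∘ₗ
    (DirectSum.decomposeLinearEquiv N.grading).toLinearMap, fun v => ?_, fun n r hn hr => ?_⟩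
  · have : ((DirectSum.decompose N.grading (N.ι v)) 1 : R) = N.ι v :=
      DirectSum.decompose_of_mem_same _ (N.ι_mem v)
    have hv : g (N.ι v) = v := LinearMap.congr_fun hg v
    change c (g ((DirectSum.decompose N.grading (N.ι v)) 1 : R)) = c v
    rw [this, hv]
  · have : ((DirectSum.decompose N.grading r) 1 : R) = 0 :=
      DirectSum.decompose_of_mem_ne _ hr hn
    change c (g ((DirectSum.decompose N.grading r) 1 : R)) = 0
    rw [this, map_zero, map_zero]

/-! ### Injectivity of the map from the presented algebra -/

section Injective

variable {A : Type*} [Ring A] [Algebra k A] (e : PlaneAlg ξ ≃ₐ[k] A) {f : A →ₐ[k] R}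
  (hfx : f (e (planeGen ξ 0)) = N.x) (hfy : f (e (planeGen ξ 1)) = N.y)

include hfx hfy

theorem map_word (i : Fin 8) : f (PlaneAlg.word (e (planeGen ξ 0)) (e (planeGen ξ 1)) i) =
    PlaneAlg.word N.x N.y i := by
  fin_cases i <;> simp [PlaneAlg.word, hfx, hfy]

/-- Both comultiplications have the same table on words. -/
theorem map_comul (r : A) : N.comul (f r) =
    TensorProduct.map f.toLinearMap f.toLinearMap (PlaneAlg.comul e r) := by
  refine LinearMap.congr_fun (f := N.comul ∘ₗ f.toLinearMap)
    (g := TensorProduct.map f.toLinearMap f.toLinearMap ∘ₗ PlaneAlg.comul e)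
    (PlaneAlg.map_linearMap_ext e fun i => ?_) r
  rw [LinearMap.comp_apply, LinearMap.comp_apply, AlgHom.toLinearMap_apply,
    N.map_word e hfx hfy, N.comul_word, PlaneAlg.comul_word]
  fin_cases i <;> simp [comulTable, hfx, hfy]

theorem map_counit (r : A) : N.counit (f r) = PlaneAlg.counit e r := by
  have hX : N.counit N.x = 0 := N.counit_mem 1 _ one_ne_zero (N.ι_mem _)
  have hY : N.counit N.y = 0 := N.counit_mem 1 _ one_ne_zero (N.ι_mem _)
  induction r using PlaneAlg.map_mul_induction e with
  | algebraMap r => simp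
  | x => rw [hfx, hX, PlaneAlg.counit_x]
  | y => rw [hfy, hY, PlaneAlg.counit_y]
  | mul r s hr hs => rw [map_mul, map_mul, map_mul, hr, hs]
  | add r s hr hs => rw [map_add, map_add, map_add, hr, hs]

/-- The derivation along φ ∘ f corresponds under f to the one along φ, so the former preserves the
kernel of f. -/
theorem map_skewDeriv (φ : R →ₗ[k] k) (r : A) :
    f (skewDeriv (PlaneAlg.comul e) (φ ∘ₗ f.toLinearMap) r) = skewDeriv N.comul φ (f r) := by
  simp only [skewDeriv, LinearMap.comp_apply, N.map_comul e hfx hfy]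
  induction PlaneAlg.comul e r with
  | zero => simp
  | add z w hz hw => simp only [map_add, hz, hw]
  | tmul r s => simp

/-- Realises ∂x and ∂y as derivations along pullbacks of forms on R. The form must vanish outside
R(1), as the coordinate does on words of degree other than one. Indices 4 and 1 are those of x and
y, the images of e₁ and e₂. -/
theorem exists_comp_eq_coord (j : Fin 2) : ∃ φ : R →ₗ[k] k,
    φ ∘ₗ f.toLinearMap = (PlaneAlg.mapBasis e).coord (![4, 1] j) := by
  obtain ⟨φ, h1, h0⟩ := N.exists_linearForm (LinearMap.proj j)
  refine ⟨φ, PlaneAlg.map_linearMap_ext e fun i => ?_⟩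
  rw [LinearMap.comp_apply, AlgHom.toLinearMap_apply, N.map_word e hfx hfy,
    PlaneAlg.coord_word]
  by_cases hi : PlaneAlg.wordDeg i = 1
  · have h : i = 1 ∨ i = 4 := by
      revert hi
      fin_cases i <;> simp [PlaneAlg.wordDeg]
    rcases h with rfl | rfl
    · refine (h1 _).trans ?_
      fin_cases j <;> simp
    · refine (h1 _).trans ?_
      fin_cases j <;> simp
  · rw [h0 _ _ hi (N.word_mem i), if_neg]
    rintro rfl
    revert hi
    fin_cases j <;> simp [PlaneAlg.wordDeg]

/-- The kernel of f lies in the kernel of ε and is stable under ∂x and ∂y, hence is zero. -/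
theorem injective_of_map_gen : Function.Injective f := by
  obtain ⟨φ, hφ⟩ := N.exists_comp_eq_coord e hfx hfy 0
  obtain ⟨ψ, hψ⟩ := N.exists_comp_eq_coord e hfx hfy 1
  refine (injective_iff_map_eq_zero f).mpr fun r hr => ?_
  refine PlaneAlg.eq_zero_of_mem_of_deriv_mem e hξ (S := LinearMap.ker f.toLinearMap) ?_ ?_ ?_ hr
  · intro r hr
    rw [← N.map_counit e hfx hfy, show f r = 0 from hr, map_zero]
  · intro r hr
    have := N.map_skewDeriv e hfx hfy φ r
    rw [hφ, show f r = 0 from hr, map_zero] at this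
    exact this
  · intro r hr
    have := N.map_skewDeriv e hfx hfy ψ r
    rw [hψ, show f r = 0 from hr, map_zero] at this
    exact this

end Injective

theorem ofPlane_bijective : Function.Bijective N.ofPlane :=
  ⟨N.injective_of_map_gen AlgEquiv.refl N.ofPlane_x N.ofPlane_y, N.ofPlane_surjective⟩

end NicholsAlgebra

end

theorem mainTheorem8 {k : Type u} [Field k] [IsAlgClosed k] [CharZero k]
    {ξ : k} (hξ : IsPrimitiveRoot ξ 4) :
    (∃ N : NicholsAlgebra (HopfK.v23 hξ) (PlaneAlg ξ),
      N.ι (Pi.single 0 1) = planeGen ξ 0 ∧ N.ι (Pi.single 1 1) = planeGen ξ 1) ∧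
    Module.finrank k (PlaneAlg ξ) = 8 ∧
    ∀ (R : Type w) [Ring R] [Algebra k R] (N : NicholsAlgebra (HopfK.v23 hξ) R),
      (∃ f : PlaneAlg ξ ≃ₐ[k] R,
        f (planeGen ξ 0) = N.ι (Pi.single 0 1) ∧ f (planeGen ξ 1) = N.ι (Pi.single 1 1)) ∧
      Module.finrank k R = 8 := by
  refine ⟨⟨PlaneAlg.nicholsAlgebra AlgEquiv.refl hξ, PlaneAlg.incl_zero _, PlaneAlg.incl_one _⟩,
    PlaneAlg.finrank_eq ξ, fun R _ _ N => ?_⟩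
  let f : PlaneAlg ξ ≃ₐ[k] R := AlgEquiv.ofBijective N.ofPlane N.ofPlane_bijective
  refine ⟨⟨f, N.ofPlane_x, N.ofPlane_y⟩, ?_⟩
  rw [← f.toLinearEquiv.finrank_eq, PlaneAlg.finrank_eq]
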